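/- **Setting.** Consider the perturbed double integrator $\dot x_1=x_2$, $\dot x_2=u+\delta(t)$ for $t\ge t_0\ge 0$, where solutions are Filippov solutions on $[t_0,\infty)$. The admissible disturbances are the measurable $\delta$ with $|\delta(t)|\le L$ for all $t\ge t_0$, for a known constant $L$. Write $\lfloor x\rceil^{a}=|x|^{a}\operatorname{sign}(x)$. The feedback $u$ may depend on $t_0$, $t$ and $x$. * The system is *asymptotically stable* if for every $t_0\ge0$: for each $\varepsilon>0$ there is $d>0$ such that $\|x(t_0)\|<d$ implies $\|x(t)\|<\varepsilon$ for all $t\ge t_0$, for all admissible disturbances and all trajectories; and all trajectories converge to $0$ as $t\to\infty$. * The *settling-time function* is $T(x_0,t_0)=\inf\{\xi\ge t_0:\lim_{t\to\xi}x(t)=0\text{ for all admissible }\delta\text{ and all trajectories with }x(t_0)=x_0\}-t_0\in[0,+\infty]$. * The system is *fixed-time stable* if it is asymptotically stable and $T$ is bounded on $\mathbb R^2\times[0,\infty)$. Any $T_{\max}$ with $T(x_0,t_0)\le T_{\max}$ for all $x_0\in\mathbb R^2$, $t_0\ge0$ is called an upper bound of the settling time (UBST). **Data.** Let $\alpha,T_c,\alpha_1,\alpha_2,\beta_1,\beta_2,p,q,k,T_{c_1},T_{c_2}>0$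 with $kp<1<kq$, and put $\eta=1-e^{-\alpha(T_{c_1}+T_{c_2})}$. Let $\zeta$ satisfy $\zeta(\tau)\ge(\alpha\eta^{-1}T_ce^{-\alpha\tau})^2L$ for all $\tau\ge0$. Let $w_L:\mathbb R^2\to\mathbb R$ be an autonomous feedback such that, for each disturbance bounded by $L$, the double integrator with $u=w_L(x)$ is asymptotically stable. Put $$\gamma_1=\frac{\Gamma(\frac14)^2}{2\alpha_1^{1/2}\Gamma(\frac12)}\Big(\frac{\alpha_1}{\beta_1}\Big)^{1/4},\quad \gamma_2=\frac{\Gamma(m_p)\Gamma(m_q)}{\alpha_2^{k}\Gamma(k)(q-p)}\Big(\frac{\alpha_2}{\beta_2}\Big)^{m_p},\quad m_p=\frac{1-kp}{q-p},\quad m_q=\frac{kq-1}{q-p},$$ $$\sigma(z)=z_2+\Big\lfloor\lfloor z_2\rceil^2+\frac{2\gamma_1^2}{T_{c_1}^2}\big(\alpha_1\lfloor z_1\rceil^1+\beta_1\lfloor z_1\rceil^3\big)\Big\rceil^{1/2},$$ $$w(z,\tau)=-\Big[\frac{\gamma_2}{T_{c_2}}\big(\alpha_2|\sigma|^p+\beta_2|\sigma|^q\big)^k+\frac{\gamma_1^2}{2T_{c_1}^2}\big(\alpha_1+3\beta_1z_1^2\big)+\zeta(\tau)\Big]\operatorname{sign}(\sigma).$$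 Let $A=\begin{pmatrix}0&1\\0&-\alpha\end{pmatrix}$ and $B=\begin{pmatrix}0\\1\end{pmatrix}$, let $s^2+a_1s+a_2$ be the characteristic polynomial of $A$, and let $Q=[B,\,AB]\begin{pmatrix}a_1&1\\1&0\end{pmatrix}$. Put $\upsilon(y,\tau)=\big[w(z,\tau)+a_2z_1+a_1z_2\big]_{z=Q^{-1}y}$. (Explicitly, $a_1=\alpha$, $a_2=0$, $Q=I$.) Let $\kappa(s)=\frac{\eta}{\alpha(T_c-\eta s)}$ for $0\le s<T_c$ and $\kappa(s)=1$ otherwise. The controller is $$u=\begin{cases}\kappa(t-t_0)^2\,\upsilon\big(\operatorname{diag}(1,\kappa(t-t_0))^{-1}x,\ \tau\big),\quad \tau=-\alpha^{-1}\ln\!\big(1-\eta(t-t_0)/T_c\big), & t\in[t_0,t_0+T_c),\\ w_L(x),&\text{otherwise.}\end{cases}$$ **Claim.** The closed-loop system is fixed-time stable with $T_c$ as a UBST. More precisely, $T(x_0,t_0)\le T_c$ for all $x_0\in\mathbb R^2$ and $t_0\ge0$, and every trajectory satisfies $x(t)=0$ for all $t\ge t_0+T_c$. Moreover, $\kappa(t-t_0)$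 is bounded for $t\in[t_0,t_0+T_c]$, uniformly in $t_0$. -/

import Mathlib

open MeasureTheory Set Filter Topology

noncomputable section

/-! ### Filippov solutions of the controlled double integrator -/

/-- State space of the double integrator; `x 0`, `x 1` are the coordinates `x₁`, `x₂`.
All notions below depend on the norm only up to equivalence. -/
abbrev State := Fin 2 → ℝ

/-- Filippov regularization of a (time-varying, possibly discontinuous) vector field. -/
def filippovMap (f : ℝ → State → State) (t : ℝ) (x : State) : Set State :=
  ⋂ (r : ℝ) (_ : 0 < r) (N : Set State) (_ : volume N = 0),
    closure (convexHull ℝ (f t '' (Metric.ball x r \ N)))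

/-- `x` is a Filippov solution of `ẋ = f(t, x)` on `[t₀, ∞)`: locally absolutely continuous, with
derivative in the Filippov set for almost every time. -/
structure IsFilippovSolution (f : ℝ → State → State) (t₀ : ℝ) (x : ℝ → State) : Prop where
  absCont : ∀ b, t₀ ≤ b → AbsolutelyContinuousOnInterval x t₀ b
  deriv_mem : ∀ᵐ t ∂(volume.restrict (Ici t₀)),
    ∃ v ∈ filippovMap f t (x t), HasDerivAt x v t

/-- A feedback law `u t₀ t x`; it may depend on the initial time `t₀` and on the current time. -/
abbrev ControlLaw := ℝ → ℝ → State → ℝ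

/-- Vector field of `ẋ₁ = x₂`, `ẋ₂ = u + δ(t)`. -/
def closedLoopField (u : ℝ → State → ℝ) (δ : ℝ → ℝ) (t : ℝ) (x : State) : State :=
  ![x 1, u t x + δ t]

/-- `x` is a trajectory of the closed loop that starts in `x₀` at time `t₀`. -/
def IsTrajectory (u : ControlLaw) (δ : ℝ → ℝ) (t₀ : ℝ) (x₀ : State) (x : ℝ → State) : Prop :=
  IsFilippovSolution (closedLoopField (u t₀) δ) t₀ x ∧ x t₀ = x₀

/-- The admissible disturbances on `[t₀, ∞)`. -/
def admissible (L t₀ : ℝ) : Set (ℝ → ℝ) :=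
  {δ | Measurable δ ∧ ∀ t, t₀ ≤ t → |δ t| ≤ L}

/-! ### Stability and settling time -/

/-- Global asymptotic stability of the origin, for all initial times `t₀ ≥ 0` and all
disturbances in `D t₀`: Lyapunov stability and convergence of all trajectories. -/
def AsymptoticallyStable (u : ControlLaw) (D : ℝ → Set (ℝ → ℝ)) : Prop :=
  ∀ t₀ : ℝ, 0 ≤ t₀ →
    (∀ ε : ℝ, 0 < ε → ∃ d : ℝ, 0 < d ∧ ∀ x₀ : State, ‖x₀‖ < d → ∀ δ ∈ D t₀, ∀ x : ℝ → State,
      IsTrajectory u δ t₀ x₀ x → ∀ t, t₀ ≤ t → ‖x t‖ < ε) ∧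
    (∀ x₀ : State, ∀ δ ∈ D t₀, ∀ x : ℝ → State,
      IsTrajectory u δ t₀ x₀ x → Tendsto x atTop (𝓝 0))

/-- `T(x₀, t₀) = inf {ξ ≥ t₀ : x(t) → 0 as t → ξ for all admissible disturbances} - t₀`,
with `inf ∅ = +∞`. -/
def settlingTime (u : ControlLaw) (D : ℝ → Set (ℝ → ℝ)) (x₀ : State) (t₀ : ℝ) : EReal :=
  sInf {ξ : EReal | ∃ s : ℝ, ξ = (s : EReal) ∧ t₀ ≤ s ∧
    ∀ δ ∈ D t₀, ∀ x : ℝ → State, IsTrajectory u δ t₀ x₀ x →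
      Tendsto x (𝓝[Ici t₀] s) (𝓝 0)} - (t₀ : EReal)

/-- `T` is an upper bound of the settling time over all initial states and initial times. -/
def IsUBST (u : ControlLaw) (D : ℝ → Set (ℝ → ℝ)) (T : ℝ) : Prop :=
  ∀ (x₀ : State) (t₀ : ℝ), 0 ≤ t₀ → settlingTime u D x₀ t₀ ≤ (T : EReal)

/-- Fixed-time stability: asymptotic stability together with a finite positive bound of the
settling time. -/
def FixedTimeStable (u : ControlLaw) (D : ℝ → Set (ℝ → ℝ)) : Prop :=
  AsymptoticallyStable u D ∧ ∃ T : ℝ, 0 < T ∧ IsUBST u D T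

/-- The autonomous feedback `w` asymptotically stabilizes the double integrator under each
disturbance bounded by `L`. -/
def RobustlyStabilizes (w : State → ℝ) (L : ℝ) : Prop :=
  ∀ δ : ℝ → ℝ, AsymptoticallyStable (fun _ _ x => w x) (fun t₀ => admissible L t₀ ∩ {δ})

/-! ### The redesigned controller -/

/-- Time-varying gain `κ(s)`, with `s = t - t₀`. -/
def kappa (α η Tc s : ℝ) : ℝ :=
  if 0 ≤ s ∧ s < Tc then η / (α * (Tc - η * s)) else 1

/-- Rescaled time `τ`, with `s = t - t₀`. -/
def tauOf (α η Tc s : ℝ) : ℝ := -α⁻¹ * Real.log (1 - η * s / Tc)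

/-- `Ω = diag(1, κ)`. -/
def omegaMat (κ : ℝ) : Matrix (Fin 2) (Fin 2) ℝ := Matrix.diagonal fun i => κ ^ (i : ℕ)

/-- Linear part `A` of the auxiliary system `dy₁/dτ = y₂`, `dy₂/dτ = υ - α y₂ + π`. -/
def auxA (α : ℝ) : Matrix (Fin 2) (Fin 2) ℝ := !![0, 1; 0, -α]

/-- Input matrix `B` of the auxiliary system. -/
def auxB : Matrix (Fin 2) (Fin 1) ℝ := !![0; 1]

/-- Coefficient `a₁` of the characteristic polynomial `s² + a₁ s + a₂` of `A`. -/
def coeffOne (α : ℝ) : ℝ := (auxA α).charpoly.coeff 1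

/-- Coefficient `a₂` of the characteristic polynomial `s² + a₁ s + a₂` of `A`. -/
def coeffTwo (α : ℝ) : ℝ := (auxA α).charpoly.coeff 0

/-- Controllability matrix `[B, A B]`. -/
def controllability (α : ℝ) : Matrix (Fin 2) (Fin 2) ℝ :=
  Matrix.of fun i j => (auxA α ^ (j : ℕ) * auxB) i 0

/-- The transformation `y = Q z` to the controller canonical form. -/
def transQ (α : ℝ) : Matrix (Fin 2) (Fin 2) ℝ :=
  controllability α * !![coeffOne α, 1; 1, 0]

/-- `υ(y, τ) = [w(z, τ) + a₂ z₁ + a₁ z₂]` at `z = Q⁻¹ y`. -/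
def upsilon (α : ℝ) (w : State → ℝ → ℝ) (y : State) (τ : ℝ) : ℝ :=
  let z : State := (transQ α)⁻¹.mulVec y
  w z τ + coeffTwo α * z 0 + coeffOne α * z 1

/-- The piecewise controller: `κⁿ υ(Ω⁻¹ x, τ)` with `n = 2` on `[t₀, t₀ + Tc)`, and `wL(x)`
otherwise. -/
def redesigned (α η Tc : ℝ) (w : State → ℝ → ℝ) (wL : State → ℝ) : ControlLaw :=
  fun t₀ t x =>
    if t₀ ≤ t ∧ t < t₀ + Tc then
      kappa α η Tc (t - t₀) ^ 2 *
        upsilon α w ((omegaMat (kappa α η Tc (t - t₀)))⁻¹.mulVec x) (tauOf α η Tc (t - t₀))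
    else wL x

/-! ### The second-order fixed-time controller -/

/-- Signed power `|x|ᵃ sign x`. -/
def spow (x a : ℝ) : ℝ := |x| ^ a * Real.sign x

def gammaOne (α₁ β₁ : ℝ) : ℝ :=
  Real.Gamma (1 / 4) ^ 2 / (2 * α₁ ^ (1 / 2 : ℝ) * Real.Gamma (1 / 2)) *
    (α₁ / β₁) ^ (1 / 4 : ℝ)

def mP (p q k : ℝ) : ℝ := (1 - k * p) / (q - p)

def mQ (p q k : ℝ) : ℝ := (k * q - 1) / (q - p)

def gammaTwo (α₂ β₂ p q k : ℝ) : ℝ :=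
  Real.Gamma (mP p q k) * Real.Gamma (mQ p q k) / (α₂ ^ k * Real.Gamma k * (q - p)) *
    (α₂ / β₂) ^ mP p q k

/-- The sliding variable `σ`. -/
def sigmaVar (α₁ β₁ Tc₁ : ℝ) (z : State) : ℝ :=
  z 1 + spow (spow (z 1) 2 +
    2 * gammaOne α₁ β₁ ^ 2 / Tc₁ ^ 2 * (α₁ * spow (z 0) 1 + β₁ * spow (z 0) 3)) (1 / 2)

/-- The second-order controller with disturbance-compensating term `ζ(τ)`. -/
def slidingControl (α₁ α₂ β₁ β₂ p q k Tc₁ Tc₂ : ℝ) (ζ : ℝ → ℝ) (z : State) (τ : ℝ) : ℝ :=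
  -(gammaTwo α₂ β₂ p q k / Tc₂ *
        (α₂ * |sigmaVar α₁ β₁ Tc₁ z| ^ p + β₂ * |sigmaVar α₁ β₁ Tc₁ z| ^ q) ^ k +
      gammaOne α₁ β₁ ^ 2 / (2 * Tc₁ ^ 2) * (α₁ + 3 * β₁ * z 0 ^ 2) + ζ τ) *
    Real.sign (sigmaVar α₁ β₁ Tc₁ z)

end

noncomputable section

/-! Put z₁ = x₁, z₂ = x₂/κ and measure time by the clock τ with dτ/dt = κ. Since 1/κ is affine in t
with slope -α, the term αz₂ of the controller cancels and the double integrator dz₁/dτ = z₂, dz₂/dτ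
= w + δ/κ² remains, with |δ|/κ² dominated by ζ. The choice of η makes τ run from 0 to exactly Tc₁ +
Tc₂ over the horizon while κ stays bounded, so it suffices that z vanishes before the clock gets
there (`ReachingFlow.exists_eq_zero`).

Away from σ = 0 the Filippov set is a single vector, which gives the inequalities of `ReachingFlow`;
on σ = 0 nothing is assumed about the input. The C¹ function P = `switchFun` has the sign of σ, and
its positive and negative parts decrease, so the surface is never left once reached. On it |z₂| =
√(|g(z₁)|/2), directed towards the origin, and the remaining time is at most `travelTime g 0 |z₁|` <
Tc₁. The constants γ₁ and γ₂ are Beta integrals that normalise the total sliding time to Tc₁ and the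
total time of the reaching law to Tc₂.

These two bounds cannot simply be added, because the decay of σ is proved only for z₁ ≥ 0. Take P >
0; the other sign follows by symmetry. For z₁ ≤ 0 the flow moves towards z₁ = 0 at least as fast as
on the surface (`clock_le_travel`). For z₁ ≥ 0 the quantity `reachTime c σ + travelTime g w z₁ + τ`
is nonincreasing (`potential_deriv_nonpos`): the surplus decay of σ pays for the growth of z₁. With
the level w of P at the crossing of z₁ = 0 the legs telescope, and `travelTime_gain_mono` absorbs
the final sliding leg. The total is at most Tc₂ plus the sliding time from the largest excursion
(`clock_le`), which is strictly less than Tc₁ + Tc₂.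

After the horizon the state is at the origin, and Lyapunov stability under wL keeps it there. -/

/-! ### Beta integrals behind the constants γ₁ and γ₂ -/

theorem image_div_add_rpow_Ioi {a b r : ℝ} (ha : 0 < a) (hb : 0 < b) (hr : 0 < r) :
    (fun x : ℝ => b * x ^ r / (a + b * x ^ r)) '' Ioi 0 = Ioo 0 1 := by
  ext y
  constructor
  · rintro ⟨x, hx, rfl⟩
    have : 0 < x ^ r := Real.rpow_pos_of_pos hx r
    refine ⟨by positivity, ?_⟩
    rw [div_lt_one (by positivity)]
    linarith
  · rintro ⟨h0, h1⟩
    have h2 : 0 < 1 - y := by linarith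
    have h3 : 0 < a * y / (b * (1 - y)) := by positivity
    refine ⟨(a * y / (b * (1 - y))) ^ r⁻¹, Real.rpow_pos_of_pos h3 _, ?_⟩
    simp only
    rw [Real.rpow_inv_rpow h3.le hr.ne']
    field_simp
    ring

theorem hasDerivAt_div_add_rpow {a b r x : ℝ} (ha : 0 < a) (hb : 0 < b) (hx : 0 < x) :
    HasDerivAt (fun x : ℝ => b * x ^ r / (a + b * x ^ r))
      (a * b * r * x ^ (r - 1) / (a + b * x ^ r) ^ 2) x := by
  have hpos : 0 < x ^ r := Real.rpow_pos_of_pos hx r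
  have h := (Real.hasDerivAt_rpow_const (p := r) (Or.inl hx.ne')).const_mul b
  have h' := h.div (h.const_add a) (by positivity)
  refine h'.congr_deriv ?_
  field_simp
  ring

theorem injOn_div_add_rpow {a b r : ℝ} (ha : 0 < a) (hb : 0 < b) (hr : 0 < r) :
    InjOn (fun x : ℝ => b * x ^ r / (a + b * x ^ r)) (Ioi 0) := by
  intro x hx y hy hxy
  have hx' : 0 < x ^ r := Real.rpow_pos_of_pos hx r
  have hy' : 0 < y ^ r := Real.rpow_pos_of_pos hy r
  simp only at hxy
  rw [div_eq_div_iff (by positivity) (by positivity)] at hxy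
  have h1 : a * b * x ^ r = a * b * y ^ r := by linarith
  have h2 : x ^ r = y ^ r := mul_left_cancel₀ (by positivity) h1
  exact (Real.rpow_left_inj (le_of_lt hx) (le_of_lt hy) hr.ne').1 h2

/-- Since mP + mQ = k, the substitution y = b x^(q-p) / (a + b x^(q-p)) turns the Beta density with
these parameters into a multiple of the reciprocal reaching speed, and γ₂ is precisely the
normalising constant. -/
theorem betaPDF_comp_div_add_rpow {a b p q k x : ℝ} (ha : 0 < a) (hb : 0 < b) (hpq : p < q)
    (hkp : k * p < 1) (hkq : 1 < k * q) (hx : 0 < x) :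
    (a * b * (q - p) * x ^ (q - p - 1) / (a + b * x ^ (q - p)) ^ 2) *
      ProbabilityTheory.betaPDFReal (mP p q k) (mQ p q k)
        (b * x ^ (q - p) / (a + b * x ^ (q - p))) =
      (gammaTwo a b p q k)⁻¹ * (a * x ^ p + b * x ^ q) ^ (-k) := by
  have hr : 0 < q - p := by linarith
  have hX : 0 < x ^ (q - p) := Real.rpow_pos_of_pos hx _
  have hmp : 0 < mP p q k := div_pos (by linarith) hr
  have hmq : 0 < mQ p q k := div_pos (by linarith) hr
  have hsum : mP p q k + mQ p q k = k := by
    unfold mP mQ; field_simp; ring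
  have hk : 0 < k := by linarith
  have hmem : (0:ℝ) < b * x ^ (q - p) / (a + b * x ^ (q - p)) ∧
      b * x ^ (q - p) / (a + b * x ^ (q - p)) < 1 := by
    refine ⟨by positivity, ?_⟩
    rw [div_lt_one (by positivity)]
    linarith
  unfold ProbabilityTheory.betaPDFReal
  rw [if_pos hmem, ProbabilityTheory.beta, hsum]
  have e1 : (1:ℝ) - b * x ^ (q - p) / (a + b * x ^ (q - p)) = a / (a + b * x ^ (q - p)) := by
    field_simp; ring
  have e2 : a * x ^ p + b * x ^ q = x ^ p * (a + b * x ^ (q - p)) := by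
    rw [Real.rpow_sub hx]; field_simp [(Real.rpow_pos_of_pos hx p).ne']
  set Y := a + b * x ^ (q - p) with hY
  have hYpos : 0 < Y := by positivity
  have hmq' : mQ p q k = k - mP p q k := by linarith
  have e4 : x ^ ((q - p) * mP p q k) = x ^ (1 - k * p) := by
    congr 1; unfold mP; field_simp
  rw [e1, e2]
  unfold gammaTwo
  have hG1 := Real.Gamma_pos_of_pos hmp
  have hG2 := Real.Gamma_pos_of_pos hmq
  have hG3 := Real.Gamma_pos_of_pos hk
  generalize Real.Gamma (mP p q k) = G1 at *
  generalize Real.Gamma (mQ p q k) = G2 at *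
  generalize Real.Gamma k = G3 at *
  rw [hmq']
  generalize mP p q k = m at *
  -- Every power is split until only the atoms x^(kp), a^k, a^m, b^m, Y^k, Y^m and integer or single
  -- powers remain; the identity is then rational.
  rw [Real.div_rpow (by positivity) hYpos.le, Real.div_rpow ha.le hYpos.le,
    Real.div_rpow ha.le hb.le, Real.mul_rpow hb.le hX.le,
    Real.mul_rpow (Real.rpow_nonneg hx.le p) hYpos.le, ← Real.rpow_mul hx.le, ← Real.rpow_mul hx.le,
    show (q - p) * (m - 1) = (q - p) * m - (q - p) by ring,
    Real.rpow_sub hx ((q - p) * m), e4, Real.rpow_sub hx 1 (k * p), Real.rpow_sub hx (q - p) 1,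
    show p * -k = -(k * p) by ring, Real.rpow_neg hx.le, Real.rpow_neg hYpos.le,
    Real.rpow_sub hYpos m 1, show k - m - 1 = k - (m + 1) by ring, Real.rpow_sub hYpos k,
    Real.rpow_add hYpos m 1, Real.rpow_sub ha k, Real.rpow_add ha m 1, Real.rpow_sub hb m 1]
  simp only [Real.rpow_one]
  have := Real.rpow_pos_of_pos ha k
  have := Real.rpow_pos_of_pos ha m
  have := Real.rpow_pos_of_pos hb m
  have := Real.rpow_pos_of_pos hYpos k
  have := Real.rpow_pos_of_pos hYpos m
  have := Real.rpow_pos_of_pos hx (k * p)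
  field_simp

theorem gammaTwo_pos {a b p q k : ℝ} (ha : 0 < a) (hb : 0 < b) (hpq : p < q)
    (hkp : k * p < 1) (hkq : 1 < k * q) (hk : 0 < k) : 0 < gammaTwo a b p q k := by
  have hr : 0 < q - p := by linarith
  have hmp : 0 < mP p q k := div_pos (by linarith) hr
  have hmq : 0 < mQ p q k := div_pos (by linarith) hr
  have hG1 := Real.Gamma_pos_of_pos hmp
  have hG2 := Real.Gamma_pos_of_pos hmq
  have hG3 := Real.Gamma_pos_of_pos hk
  unfold gammaTwo
  positivity

/-- The Beta law has mass one, and the substitution maps (0, ∞) bijectively onto (0, 1). Working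
with the lower integral yields integrability and value together. -/
theorem lintegral_rpow_add_rpow {a b p q k : ℝ} (ha : 0 < a) (hb : 0 < b) (hpq : p < q)
    (hkp : k * p < 1) (hkq : 1 < k * q) :
    ∫⁻ x in Ioi (0:ℝ), ENNReal.ofReal
      ((gammaTwo a b p q k)⁻¹ * (a * x ^ p + b * x ^ q) ^ (-k)) = 1 := by
  have hr : 0 < q - p := by linarith
  have hmp : 0 < mP p q k := div_pos (by linarith) hr
  have hmq : 0 < mQ p q k := div_pos (by linarith) hr
  have h1 := ProbabilityTheory.lintegral_betaPDF_eq_one hmp hmq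
  have h2 : ∫⁻ x in Ioo (0:ℝ) 1, ProbabilityTheory.betaPDF (mP p q k) (mQ p q k) x = 1 := by
    rw [← h1]
    refine setLIntegral_eq_of_support_subset ?_
    intro x hx
    by_contra hcon
    apply hx
    simp only [mem_Ioo, not_and_or, not_lt] at hcon
    rcases hcon with h | h
    · exact ProbabilityTheory.betaPDF_eq_zero_of_nonpos h
    · exact ProbabilityTheory.betaPDF_eq_zero_of_one_le h
  rw [← image_div_add_rpow_Ioi ha hb hr, lintegral_image_eq_lintegral_abs_deriv_mul
    measurableSet_Ioi (fun x hx => (hasDerivAt_div_add_rpow ha hb hx).hasDerivWithinAt)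
    (injOn_div_add_rpow ha hb hr)] at h2
  rw [← h2]
  refine setLIntegral_congr_fun measurableSet_Ioi fun x hx => ?_
  have hx' : (0:ℝ) < x := hx
  have hX : 0 < x ^ (q - p) := Real.rpow_pos_of_pos hx _
  rw [abs_of_nonneg (by positivity), ProbabilityTheory.betaPDF, ← ENNReal.ofReal_mul (by positivity),
    betaPDF_comp_div_add_rpow ha hb hpq hkp hkq hx]

theorem integrableOn_rpow_add_rpow {a b p q k : ℝ} (ha : 0 < a) (hb : 0 < b) (hpq : p < q)
    (hkp : k * p < 1) (hkq : 1 < k * q) (hk : 0 < k) :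
    IntegrableOn (fun x : ℝ => (a * x ^ p + b * x ^ q) ^ (-k)) (Ioi 0) ∧
      ∫ x in Ioi (0:ℝ), (a * x ^ p + b * x ^ q) ^ (-k) = gammaTwo a b p q k := by
  have hγ := gammaTwo_pos ha hb hpq hkp hkq hk
  have h1 := lintegral_rpow_add_rpow ha hb hpq hkp hkq
  have hnn : 0 ≤ᵐ[volume.restrict (Ioi (0:ℝ))]
      fun x => (gammaTwo a b p q k)⁻¹ * (a * x ^ p + b * x ^ q) ^ (-k) := by
    filter_upwards [ae_restrict_mem measurableSet_Ioi] with x hx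
    have hx' : (0:ℝ) < x := hx
    have := Real.rpow_nonneg hx'.le p
    have := Real.rpow_nonneg hx'.le q
    simp only [Pi.zero_apply]
    positivity
  have hm : AEStronglyMeasurable (fun x : ℝ => (gammaTwo a b p q k)⁻¹ *
      (a * x ^ p + b * x ^ q) ^ (-k)) (volume.restrict (Ioi (0:ℝ))) :=
    Measurable.aestronglyMeasurable (by fun_prop)
  have hint : IntegrableOn (fun x : ℝ => (gammaTwo a b p q k)⁻¹ *
      (a * x ^ p + b * x ^ q) ^ (-k)) (Ioi 0) := by
    refine ⟨hm, ?_⟩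
    rw [hasFiniteIntegral_iff_ofReal hnn, h1]
    exact ENNReal.one_lt_top
  have hval : ∫ x in Ioi (0:ℝ), (gammaTwo a b p q k)⁻¹ * (a * x ^ p + b * x ^ q) ^ (-k) = 1 := by
    rw [integral_eq_lintegral_of_nonneg_ae hnn hm, h1]; simp
  constructor
  · refine (hint.const_mul (gammaTwo a b p q k)).congr ?_
    filter_upwards with x
    field_simp
  · rw [integral_const_mul] at hval
    field_simp at hval
    linarith

/-! ### Absolutely continuous functions: composition and monotonicity -/

theorem AbsolutelyContinuousOnInterval.comp_lipschitzOn {X Y : Type*} [PseudoMetricSpace X]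
    [PseudoMetricSpace Y] {f : ℝ → X} {φ : X → Y} {a b : ℝ} {K : NNReal} {S : Set X}
    (hφ : LipschitzOnWith K φ S) (hf : AbsolutelyContinuousOnInterval f a b)
    (hS : ∀ t ∈ uIcc a b, f t ∈ S) : AbsolutelyContinuousOnInterval (fun t => φ (f t)) a b := by
  rw [absolutelyContinuousOnInterval_iff] at hf ⊢
  intro ε hε
  -- K + 1 instead of K keeps the division legitimate when K = 0.
  obtain ⟨d, hd, h⟩ := hf (ε / (K + 1)) (by positivity)
  refine ⟨d, hd, fun E hE hlt => ?_⟩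
  have h1 := h E hE hlt
  calc ∑ i ∈ Finset.range E.1, dist (φ (f (E.2 i).1)) (φ (f (E.2 i).2))
      ≤ ∑ i ∈ Finset.range E.1, K * dist (f (E.2 i).1) (f (E.2 i).2) :=
        Finset.sum_le_sum fun i hi =>
          hφ.dist_le_mul _ (hS _ (hE.1 i hi).1) _ (hS _ (hE.1 i hi).2)
    _ = K * ∑ i ∈ Finset.range E.1, dist (f (E.2 i).1) (f (E.2 i).2) := by rw [Finset.mul_sum]
    _ ≤ (K + 1) * ∑ i ∈ Finset.range E.1, dist (f (E.2 i).1) (f (E.2 i).2) := by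
        gcongr
        linarith
    _ < (K + 1) * (ε / (K + 1)) := by gcongr
    _ = ε := by field_simp

/-- Composition with a function that is continuously differentiable on an order-convex set. -/
theorem AbsolutelyContinuousOnInterval.comp_deriv {f φ φ' : ℝ → ℝ} {a b : ℝ} {S : Set ℝ}
    (hf : AbsolutelyContinuousOnInterval f a b)
    (hφ : ∀ x ∈ S, HasDerivAt φ (φ' x) x) (hφ' : ContinuousOn φ' S)
    (hfS : ∀ t ∈ uIcc a b, f t ∈ S) : AbsolutelyContinuousOnInterval (fun t => φ (f t)) a b := by
  have hc : IsCompact (f '' uIcc a b) := isCompact_uIcc.image_of_continuousOn hf.continuousOn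
  -- The image of the interval is compact and connected, hence convex in ℝ, so a bound on φ' over it
  -- is a Lipschitz constant; S itself need not be convex.
  have hconn : IsPreconnected (f '' uIcc a b) :=
    isPreconnected_uIcc.image _ hf.continuousOn
  have hsub : f '' uIcc a b ⊆ S := by rintro _ ⟨t, ht, rfl⟩; exact hfS t ht
  obtain ⟨C, hC⟩ := hc.exists_bound_of_continuousOn (hφ'.mono hsub)
  have hlip : LipschitzOnWith (Real.toNNReal C) φ (f '' uIcc a b) := by
    refine Convex.lipschitzOnWith_of_nnnorm_hasDerivWithin_le (f' := φ')
      hconn.ordConnected.convex (fun x hx => (hφ x (hsub hx)).hasDerivWithinAt) fun x hx => ?_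
    rw [← NNReal.coe_le_coe, coe_nnnorm]
    exact (hC x hx).trans (Real.le_coe_toNNReal C)
  exact hf.comp_lipschitzOn hlip fun t ht => mem_image_of_mem f ht

theorem absolutelyContinuousOnInterval_of_hasDerivAt {f f' : ℝ → ℝ} {a b : ℝ}
    (hf : ∀ t ∈ uIcc a b, HasDerivAt f (f' t) t) (hf' : ContinuousOn f' (uIcc a b)) :
    AbsolutelyContinuousOnInterval f a b := by
  have hid : AbsolutelyContinuousOnInterval (fun t : ℝ => t) a b :=
    (LipschitzWith.id.lipschitzOnWith).absolutelyContinuousOnInterval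
  exact hid.comp_deriv (S := uIcc a b) hf hf' fun t ht => ht

/-- Absolute continuity makes the increment the integral of the derivative, so a sign almost
everywhere suffices. Every estimate along the flow passes through this. -/
theorem AbsolutelyContinuousOnInterval.le_of_ae_hasDerivAt_nonpos {f : ℝ → ℝ} {a b : ℝ}
    (hab : a ≤ b) (hf : AbsolutelyContinuousOnInterval f a b)
    (h : ∀ᵐ t, t ∈ Ioo a b → ∃ d ≤ 0, HasDerivAt f d t) : f b ≤ f a := by
  have h1 := hf.integral_deriv_eq_sub
  have h2 : ∫ t in a..b, deriv f t ≤ 0 := by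
    rw [intervalIntegral.integral_of_le hab, integral_Ioc_eq_integral_Ioo]
    refine setIntegral_nonpos_of_ae_restrict ?_
    rw [EventuallyLE, ae_restrict_iff' measurableSet_Ioo]
    filter_upwards [h] with t ht hmem
    obtain ⟨d, hd, hder⟩ := ht hmem
    simpa [hder.deriv] using hd
  linarith

theorem hasDerivAt_mul_abs_self (x : ℝ) : HasDerivAt (fun y : ℝ => y * |y|) (2 * |x|) x := by
  rcases lt_trichotomy x 0 with h | rfl | h
  · have := (hasDerivAt_id x).mul (hasDerivAt_abs_neg h)
    refine this.congr_deriv ?_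
    simp [abs_of_neg h]; ring
  · rw [hasDerivAt_iff_tendsto_slope]
    have : Tendsto (fun y : ℝ => |y|) (𝓝[≠] 0) (𝓝 (2 * |0|)) := by
      have := (continuous_abs (G := ℝ)).tendsto 0
      simp only [abs_zero, mul_zero] at this ⊢
      exact this.mono_left nhdsWithin_le_nhds
    refine this.congr' ?_
    filter_upwards [self_mem_nhdsWithin] with y hy
    have : y ≠ 0 := hy
    simp [slope_def_field]; field_simp
  · have := (hasDerivAt_id x).mul (hasDerivAt_abs_pos h)
    refine this.congr_deriv ?_
    simp [abs_of_pos h]; ring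

/-- Squaring removes the kink of the positive part, and the derivative vanishes on the nonpositive
side. A differential inequality known only where a quantity is positive can thus be integrated
without any information elsewhere. -/
theorem hasDerivAt_posPart_sq (x : ℝ) : HasDerivAt (fun y : ℝ => max y 0 ^ 2) (2 * max x 0) x := by
  have h : (fun y : ℝ => max y 0 ^ 2) = fun y => (y * y + y * |y|) / 2 := by
    funext y
    rcases le_total y 0 with h | h
    · rw [max_eq_right h, abs_of_nonpos h]; ring
    · rw [max_eq_left h, abs_of_nonneg h]; ring
  rw [h]
  refine ((((hasDerivAt_id x).mul (hasDerivAt_id x)).add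
    (hasDerivAt_mul_abs_self x)).div_const 2).congr_deriv ?_
  rcases le_total x 0 with h | h
  · rw [max_eq_right h, abs_of_nonpos h]; simp; ring
  · rw [max_eq_left h, abs_of_nonneg h]; simp; ring

/-! ### Auxiliary functions of the sliding-mode analysis -/

/-- A smooth function with the same sign as the sliding variable. -/
def switchFun (g : ℝ → ℝ) (a b : ℝ) : ℝ := 2 * (b * |b|) + g a

/-- The sliding variable attached to the odd profile `g`. -/
def slideVar (g : ℝ → ℝ) (a b : ℝ) : ℝ :=
  b + Real.sqrt (b * |b| + g a) - Real.sqrt (-(b * |b| + g a))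

/-- An odd strictly increasing `C¹` profile. -/
structure OddProfile (g g' : ℝ → ℝ) : Prop where
  hasDerivAt : ∀ x, HasDerivAt g (g' x) x
  continuous_deriv : Continuous g'
  deriv_pos : ∀ x, 0 < g' x
  odd : ∀ x, g (-x) = -g x

namespace OddProfile
variable {g g' : ℝ → ℝ} (hg : OddProfile g g')
include hg

theorem continuous : Continuous g :=
  continuous_iff_continuousAt.2 fun x => (hg.hasDerivAt x).continuousAt

theorem strictMono : StrictMono g :=
  strictMono_of_hasDerivAt_pos hg.hasDerivAt hg.deriv_pos

theorem zero : g 0 = 0 := by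
  have := hg.odd 0
  simp at this
  linarith

theorem pos {x : ℝ} (hx : 0 < x) : 0 < g x := by
  have := hg.strictMono hx
  rwa [hg.zero] at this

theorem neg {x : ℝ} (hx : x < 0) : g x < 0 := by
  have := hg.strictMono hx
  rwa [hg.zero] at this

theorem nonneg {x : ℝ} (hx : 0 ≤ x) : 0 ≤ g x := by
  have := hg.strictMono.monotone hx
  rwa [hg.zero] at this

theorem nonpos {x : ℝ} (hx : x ≤ 0) : g x ≤ 0 := by
  have := hg.strictMono.monotone hx
  rwa [hg.zero] at this

theorem abs_apply (x : ℝ) : |g x| = g |x| := by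
  rcases le_total 0 x with h | h
  · rw [abs_of_nonneg h, abs_of_nonneg (hg.nonneg h)]
  · rw [abs_of_nonpos h, abs_of_nonpos (hg.nonpos h), hg.odd]

theorem eq_zero_of_abs_le_zero {x : ℝ} (hx : |g x| ≤ 0) : x = 0 := by
  have h : g x = 0 := abs_nonpos_iff.1 hx
  exact hg.strictMono.injective (h.trans hg.zero.symm)

theorem switchFun_neg (a b : ℝ) : switchFun g (-a) (-b) = -switchFun g a b := by
  simp only [switchFun, hg.odd, abs_neg]; ring

theorem slideVar_neg (a b : ℝ) : slideVar g (-a) (-b) = -slideVar g a b := by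
  simp only [slideVar, hg.odd, abs_neg]
  rw [show -b * |b| + -g a = -(b * |b| + g a) by ring, neg_neg]
  ring

omit hg in
-- At most one of the two roots is nonzero, so the claim is a comparison of b with a single root.
-- When that comparison is needed, squaring turns it into the sign of 2b|b| + g(a).
theorem slideVar_pos {a b : ℝ} (h : 0 < switchFun g a b) : 0 < slideVar g a b := by
  unfold switchFun at h
  unfold slideVar
  rcases le_total 0 (b * |b| + g a) with hf | hf
  · rw [Real.sqrt_eq_zero_of_nonpos (neg_nonpos.2 hf), sub_zero]
    rcases le_or_gt 0 b with hb | hb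
    · rcases hb.eq_or_lt with rfl | hb
      · simp at h ⊢; exact h
      · have := Real.sqrt_nonneg (b * |b| + g a); linarith
    · have : -b < Real.sqrt (b * |b| + g a) := by
        apply Real.lt_sqrt_of_sq_lt
        rw [abs_of_neg hb] at h ⊢
        nlinarith
      linarith
  · rw [Real.sqrt_eq_zero_of_nonpos hf, add_zero]
    have hb : 0 < b := by
      by_contra hb
      have := mul_nonpos_of_nonpos_of_nonneg (not_lt.1 hb) (abs_nonneg b)
      linarith
    have : Real.sqrt (-(b * |b| + g a)) < b := by
      rw [Real.sqrt_lt' hb]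
      rw [abs_of_pos hb] at h ⊢
      nlinarith
    linarith

theorem slideVar_neg_of {a b : ℝ} (h : switchFun g a b < 0) : slideVar g a b < 0 := by
  have h1 : 0 < switchFun g (-a) (-b) := by rw [hg.switchFun_neg]; linarith
  have := slideVar_pos h1
  rw [hg.slideVar_neg] at this
  linarith

end OddProfile

/-- The inequalities satisfied almost everywhere by the rescaled closed loop: the double integrator
with clock rate `κ` whose input dominates the reaching law off the sliding surface. -/
structure ReachingFlow (g g' c κ z₁ z₂ : ℝ → ℝ) (a b : ℝ) : Prop where
  ac_fst : ∀ t ∈ Ico a b, AbsolutelyContinuousOnInterval z₁ a t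
  ac_snd : ∀ t ∈ Ico a b, AbsolutelyContinuousOnInterval z₂ a t
  rate_pos : ∀ t ∈ Ico a b, 0 < κ t
  deriv : ∀ᵐ t, t ∈ Ioo a b → ∃ v, HasDerivAt z₁ (κ t * z₂ t) t ∧ HasDerivAt z₂ (κ t * v) t ∧
    (0 < switchFun g (z₁ t) (z₂ t) → v ≤ -(c (slideVar g (z₁ t) (z₂ t)) + g' (z₁ t) / 4)) ∧
    (switchFun g (z₁ t) (z₂ t) < 0 → c (slideVar g (z₁ t) (z₂ t)) + g' (z₁ t) / 4 ≤ v)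

/-! ### Invariance of the sliding surface and a priori bounds -/

namespace ReachingFlow
variable {g g' c κ z₁ z₂ : ℝ → ℝ} {a b : ℝ}

theorem tail (h : ReachingFlow g g' c κ z₁ z₂ a b) {s : ℝ} (hs : s ∈ Ico a b) :
    ReachingFlow g g' c κ z₁ z₂ s b where
  ac_fst t ht := (h.ac_fst t ⟨hs.1.trans ht.1, ht.2⟩).mono (by
    rw [uIcc_of_le ht.1, uIcc_of_le (hs.1.trans ht.1)]; exact Icc_subset_Icc_left hs.1)
  ac_snd t ht := (h.ac_snd t ⟨hs.1.trans ht.1, ht.2⟩).mono (by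
    rw [uIcc_of_le ht.1, uIcc_of_le (hs.1.trans ht.1)]; exact Icc_subset_Icc_left hs.1)
  rate_pos t ht := h.rate_pos t ⟨hs.1.trans ht.1, ht.2⟩
  deriv := by
    filter_upwards [h.deriv] with t ht hmem
    exact ht ⟨hs.1.trans_lt hmem.1, hmem.2⟩

/-- The central symmetry z ↦ -z exchanges the two sides of the surface, so later estimates need
proof on one side only. -/
theorem neg (hg : OddProfile g g') (hce : ∀ x, c (-x) = c x)
    (h : ReachingFlow g g' c κ z₁ z₂ a b) :
    ReachingFlow g g' c κ (fun t => -z₁ t) (fun t => -z₂ t) a b where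
  ac_fst t ht := (h.ac_fst t ht).neg
  ac_snd t ht := (h.ac_snd t ht).neg
  rate_pos := h.rate_pos
  deriv := by
    -- Evenness of g' is not a field of `OddProfile`; it follows by differentiating the oddness of
    -- g.
    have hge : ∀ x, g' (-x) = g' x := fun x => by
      have h1 := (hg.hasDerivAt (-x)).comp x (hasDerivAt_neg x)
      have h2 : HasDerivAt (fun y => -g y) (-g' x) x := (hg.hasDerivAt x).neg
      have h3 : (g ∘ Neg.neg) = fun y => -g y := funext hg.odd
      rw [h3] at h1
      have := h1.unique h2
      linarith
    filter_upwards [h.deriv] with t ht hmem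
    obtain ⟨v, h1, h2, h3, h4⟩ := ht hmem
    refine ⟨-v, h1.neg.congr_deriv (by ring), h2.neg.congr_deriv (by ring), fun hp => ?_,
      fun hp => ?_⟩
    · rw [hg.switchFun_neg] at hp
      rw [hg.slideVar_neg, hce, hge]
      linarith [h4 (by linarith)]
    · rw [hg.switchFun_neg] at hp
      rw [hg.slideVar_neg, hce, hge]
      linarith [h3 (by linarith)]

theorem ac_fst_Icc (h : ReachingFlow g g' c κ z₁ z₂ a b) {s t : ℝ} (hs : a ≤ s) (hst : s ≤ t)
    (ht : t < b) : AbsolutelyContinuousOnInterval z₁ s t :=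
  (h.tail ⟨hs, hst.trans_lt ht⟩).ac_fst t ⟨hst, ht⟩

theorem ac_snd_Icc (h : ReachingFlow g g' c κ z₁ z₂ a b) {s t : ℝ} (hs : a ≤ s) (hst : s ≤ t)
    (ht : t < b) : AbsolutelyContinuousOnInterval z₂ s t :=
  (h.tail ⟨hs, hst.trans_lt ht⟩).ac_snd t ⟨hst, ht⟩

theorem continuousOn_fst (h : ReachingFlow g g' c κ z₁ z₂ a b) {s t : ℝ} (hs : a ≤ s)
    (hst : s ≤ t) (ht : t < b) : ContinuousOn z₁ (Icc s t) := by
  have := (h.ac_fst_Icc hs hst ht).continuousOn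
  rwa [uIcc_of_le hst] at this

/-- Monotonicity of an absolutely continuous quantity along the flow. -/
theorem le_of_deriv (h : ReachingFlow g g' c κ z₁ z₂ a b) {s t : ℝ} (hs : a ≤ s) (hst : s ≤ t)
    (ht : t < b) {Φ : ℝ → ℝ} (hac : AbsolutelyContinuousOnInterval Φ s t)
    (hd : ∀ r ∈ Ioo s t, ∀ v, HasDerivAt z₁ (κ r * z₂ r) r → HasDerivAt z₂ (κ r * v) r →
      (0 < switchFun g (z₁ r) (z₂ r) → v ≤ -(c (slideVar g (z₁ r) (z₂ r)) + g' (z₁ r) / 4)) →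
      (switchFun g (z₁ r) (z₂ r) < 0 → c (slideVar g (z₁ r) (z₂ r)) + g' (z₁ r) / 4 ≤ v) →
      ∃ d ≤ 0, HasDerivAt Φ d r) : Φ t ≤ Φ s := by
  refine hac.le_of_ae_hasDerivAt_nonpos hst ?_
  filter_upwards [h.deriv] with r hr hmem
  obtain ⟨v, h1, h2, h3, h4⟩ := hr ⟨hs.trans_lt hmem.1, hmem.2.trans ht⟩
  exact hd r hmem v h1 h2 h3 h4

section
variable (hg : OddProfile g g') (h : ReachingFlow g g' c κ z₁ z₂ a b)
include hg h

theorem ac_profile {s t : ℝ} (hs : a ≤ s) (hst : s ≤ t) (ht : t < b) :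
    AbsolutelyContinuousOnInterval (fun r => g (z₁ r)) s t :=
  (h.ac_fst_Icc hs hst ht).comp_deriv (S := univ) (fun x _ => hg.hasDerivAt x)
    hg.continuous_deriv.continuousOn fun _ _ => mem_univ _

theorem ac_switch {s t : ℝ} (hs : a ≤ s) (hst : s ≤ t) (ht : t < b) :
    AbsolutelyContinuousOnInterval (fun r => switchFun g (z₁ r) (z₂ r)) s t :=
  (((h.ac_snd_Icc hs hst ht).comp_deriv (S := univ) (fun x _ => hasDerivAt_mul_abs_self x)
    (by fun_prop) fun _ _ => mem_univ _).const_mul 2).add (h.ac_profile hg hs hst ht)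

theorem continuousOn_switch {s t : ℝ} (hs : a ≤ s) (hst : s ≤ t) (ht : t < b) :
    ContinuousOn (fun r => switchFun g (z₁ r) (z₂ r)) (Icc s t) := by
  have := (h.ac_switch hg hs hst ht).continuousOn
  rwa [uIcc_of_le hst] at this

omit h in
theorem hasDerivAt_switch {r v : ℝ} (h1 : HasDerivAt z₁ (κ r * z₂ r) r)
    (h2 : HasDerivAt z₂ (κ r * v) r) :
    HasDerivAt (fun r => switchFun g (z₁ r) (z₂ r))
      (κ r * (4 * |z₂ r| * v + g' (z₁ r) * z₂ r)) r := by
  have e1 := ((hasDerivAt_mul_abs_self (z₂ r)).comp r h2).const_mul 2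
  have e2 := (hg.hasDerivAt (z₁ r)).comp r h1
  exact (e1.add e2).congr_deriv (by ring)

variable (hc : ∀ x, 0 ≤ c x)
include hc

/-- Where P > 0 the input satisfies v ≤ -g'/4, hence P' = κ(4|z₂|v + g'z₂) ≤ κg'(z₂ - |z₂|) ≤ 0;
this is where the coefficient 1/4 is needed. The squared positive part discards the region P ≤ 0. -/
theorem max_switch_le {s t : ℝ} (hs : a ≤ s) (hst : s ≤ t) (ht : t < b) :
    max (switchFun g (z₁ t) (z₂ t)) 0 ≤ max (switchFun g (z₁ s) (z₂ s)) 0 := by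
  have key : max (switchFun g (z₁ t) (z₂ t)) 0 ^ 2 ≤ max (switchFun g (z₁ s) (z₂ s)) 0 ^ 2 := by
    refine h.le_of_deriv hs hst ht (Φ := fun r => max (switchFun g (z₁ r) (z₂ r)) 0 ^ 2)
      ((h.ac_switch hg hs hst ht).comp_deriv (φ := fun y => max y 0 ^ 2) (S := univ)
        (fun x _ => hasDerivAt_posPart_sq x) (by fun_prop) fun _ _ => mem_univ _) ?_
    intro r hr v h1 h2 h3 _
    refine ⟨_, ?_, (hasDerivAt_posPart_sq _).comp r (hasDerivAt_switch hg h1 h2)⟩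
    rcases le_or_gt (switchFun g (z₁ r) (z₂ r)) 0 with hp | hp
    · rw [max_eq_right hp]; simp
    · rw [max_eq_left hp.le]
      have hκ := h.rate_pos r ⟨hs.trans hr.1.le, hr.2.trans ht⟩
      have hv : v ≤ -(g' (z₁ r) / 4) := by
        have := h3 hp
        have := hc (slideVar g (z₁ r) (z₂ r))
        linarith
      have h4 : 4 * |z₂ r| * v + g' (z₁ r) * z₂ r ≤ 0 := by
        have h5 := mul_le_mul_of_nonneg_left hv (abs_nonneg (z₂ r))
        have h6 := mul_le_mul_of_nonneg_left (le_abs_self (z₂ r)) (hg.deriv_pos (z₁ r)).le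
        nlinarith
      exact mul_nonpos_of_nonneg_of_nonpos (by positivity)
        (mul_nonpos_of_nonneg_of_nonpos hκ.le h4)
  exact (pow_le_pow_iff_left₀ (le_max_right _ _) (le_max_right _ _) two_ne_zero).1 key

theorem switch_pos_of_le {s t : ℝ} (hs : a ≤ s) (hst : s ≤ t) (ht : t < b)
    (hp : 0 < switchFun g (z₁ t) (z₂ t)) :
    0 < switchFun g (z₁ s) (z₂ s) ∧
      switchFun g (z₁ t) (z₂ t) ≤ switchFun g (z₁ s) (z₂ s) := by
  have := h.max_switch_le hg hc hs hst ht
  rw [max_eq_left hp.le] at this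
  rcases le_total (switchFun g (z₁ s) (z₂ s)) 0 with h0 | h0
  · rw [max_eq_right h0] at this; linarith
  · rw [max_eq_left h0] at this; exact ⟨by linarith, this⟩

theorem switch_nonpos {s t : ℝ} (hs : a ≤ s) (hst : s ≤ t) (ht : t < b)
    (hp : switchFun g (z₁ s) (z₂ s) ≤ 0) : switchFun g (z₁ t) (z₂ t) ≤ 0 := by
  by_contra hcon
  exact absurd (h.switch_pos_of_le hg hc hs hst ht (not_le.1 hcon)).1 (not_lt.2 hp)

/-- Neither the positive nor the negative part of P can grow, so the surface is forward invariant
although the vector field on it is left unspecified. -/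
theorem switch_eq_zero (hce : ∀ x, c (-x) = c x) {s t : ℝ} (hs : a ≤ s) (hst : s ≤ t) (ht : t < b)
    (hp : switchFun g (z₁ s) (z₂ s) = 0) : switchFun g (z₁ t) (z₂ t) = 0 := by
  refine le_antisymm (h.switch_nonpos hg hc hs hst ht hp.le) ?_
  have := (h.neg hg hce).switch_nonpos hg hc hs hst ht (by
    simp only [hg.switchFun_neg, hp, neg_zero, le_refl])
  simp only [hg.switchFun_neg] at this
  linarith

omit hc in
theorem exists_first_zero {t : ℝ} (hat : a ≤ t) (ht : t < b)
    (h0 : 0 < switchFun g (z₁ a) (z₂ a)) (h1 : switchFun g (z₁ t) (z₂ t) ≤ 0) :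
    ∃ m ∈ Ioc a t, switchFun g (z₁ m) (z₂ m) = 0 ∧
      ∀ r ∈ Ico a m, 0 < switchFun g (z₁ r) (z₂ r) := by
  set P := fun r => switchFun g (z₁ r) (z₂ r) with hP
  have hcont := h.continuousOn_switch hg le_rfl hat ht
  set S := Icc a t ∩ P ⁻¹' Iic 0 with hS
  have hSc : IsClosed S := hcont.preimage_isClosed_of_isClosed isClosed_Icc isClosed_Iic
  have hne : S.Nonempty := ⟨t, right_mem_Icc.2 hat, h1⟩
  have hbdd : BddBelow S := ⟨a, fun x hx => hx.1.1⟩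
  have hm := hSc.csInf_mem hne hbdd
  have hlt : ∀ r ∈ Ico a (sInf S), 0 < P r := fun r hr => by
    by_contra hcon
    exact absurd (csInf_le hbdd ⟨⟨hr.1, hr.2.le.trans hm.1.2⟩, not_lt.1 hcon⟩) (not_le.2 hr.2)
  have ham : a < sInf S := by
    refine lt_of_le_of_ne hm.1.1 fun heq => ?_
    have := hm.2
    rw [← heq] at this
    exact absurd h0 (not_lt.2 this)
  refine ⟨sInf S, ⟨ham, hm.1.2⟩, le_antisymm hm.2 ?_, hlt⟩
  have hcm : ContinuousWithinAt P (Ico a (sInf S)) (sInf S) :=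
    (hcont (sInf S) hm.1).mono fun r hr => ⟨hr.1, hr.2.le.trans hm.1.2⟩
  have hcl : sInf S ∈ closure (Ico a (sInf S)) := by
    rw [closure_Ico ham.ne]; exact right_mem_Icc.2 ham.le
  exact ContinuousWithinAt.closure_le hcl continuousWithinAt_const hcm fun r hr => (hlt r hr).le

theorem snd_antitone {s t : ℝ} (hs : a ≤ s) (hst : s ≤ t) (ht : t < b)
    (hp : ∀ r ∈ Ico s t, 0 < switchFun g (z₁ r) (z₂ r)) : z₂ t ≤ z₂ s := by
  refine h.le_of_deriv hs hst ht (h.ac_snd_Icc hs hst ht) ?_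
  intro r hr v _ h2 h3 _
  refine ⟨_, ?_, h2⟩
  have hκ := h.rate_pos r ⟨hs.trans hr.1.le, hr.2.trans ht⟩
  have := h3 (hp r ⟨hr.1.le, hr.2⟩)
  have := hc (slideVar g (z₁ r) (z₂ r))
  have := hg.deriv_pos (z₁ r)
  exact mul_nonpos_of_nonneg_of_nonpos hκ.le (by linarith)

/-- For z₂ ≥ 0 the bound v ≤ -g'/4 cancels g'z₂. For z₂ < 0 the input has no lower bound and z₂² may
grow, which is why only the positive part of z₂ enters the energy. -/
theorem energy_le {s t : ℝ} (hs : a ≤ s) (hst : s ≤ t) (ht : t < b)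
    (hp : ∀ r ∈ Ico s t, 0 < switchFun g (z₁ r) (z₂ r)) :
    g (z₁ t) + 2 * max (z₂ t) 0 ^ 2 ≤ g (z₁ s) + 2 * max (z₂ s) 0 ^ 2 := by
  refine h.le_of_deriv hs hst ht (Φ := fun r => g (z₁ r) + 2 * max (z₂ r) 0 ^ 2)
    ((h.ac_profile hg hs hst ht).add
      (((h.ac_snd_Icc hs hst ht).comp_deriv (φ := fun y => max y 0 ^ 2) (S := univ)
        (fun x _ => hasDerivAt_posPart_sq x) (by fun_prop) fun _ _ => mem_univ _).const_mul 2)) ?_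
  intro r hr v h1 h2 h3 _
  refine ⟨_, ?_, ((hg.hasDerivAt _).comp r h1).add
    (((hasDerivAt_posPart_sq _).comp r h2).const_mul 2)⟩
  have hκ := h.rate_pos r ⟨hs.trans hr.1.le, hr.2.trans ht⟩
  have hv := h3 (hp r ⟨hr.1.le, hr.2⟩)
  have := hc (slideVar g (z₁ r) (z₂ r))
  have hgp := hg.deriv_pos (z₁ r)
  have : g' (z₁ r) * z₂ r + 4 * max (z₂ r) 0 * v ≤ 0 := by
    rcases le_total (z₂ r) 0 with hz | hz
    · rw [max_eq_right hz]; nlinarith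
    · rw [max_eq_left hz]; nlinarith
  nlinarith

omit hg hc in
theorem fst_monotone {s t : ℝ} (hs : a ≤ s) (hst : s ≤ t) (ht : t < b)
    (hp : ∀ r ∈ Ioo s t, 0 ≤ z₂ r) : z₁ s ≤ z₁ t := by
  have := h.le_of_deriv hs hst ht (Φ := fun r => -z₁ r) (h.ac_fst_Icc hs hst ht).neg ?_
  · linarith
  intro r hr v h1 _ _ _
  refine ⟨_, ?_, h1.neg⟩
  have hκ := h.rate_pos r ⟨hs.trans hr.1.le, hr.2.trans ht⟩
  have := mul_nonneg hκ.le (hp r hr)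
  linarith

omit h hc hg in
-- These relations between the coordinates, with z₁' = κz₂, are the whole sliding dynamics; no
-- equivalent control has to be computed.
theorem two_mul_sq_eq_of_switch_eq_zero {x y : ℝ} (h0 : switchFun g x y = 0) :
    2 * y ^ 2 = |g x| ∧ g x * y ≤ 0 := by
  have h1 : g x = -(2 * (y * |y|)) := by unfold switchFun at h0; linarith
  constructor
  · rw [h1, abs_neg, abs_mul, abs_mul, abs_abs, abs_mul_abs_self, abs_two]; ring
  · rw [h1]
    have := mul_nonneg (mul_self_nonneg y) (abs_nonneg y)
    nlinarith

/-- On the sliding surface the first coordinate contracts. -/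
theorem sliding_abs_le (hce : ∀ x, c (-x) = c x) {s t : ℝ} (hs : a ≤ s) (hst : s ≤ t) (ht : t < b)
    (hp : switchFun g (z₁ s) (z₂ s) = 0) : |g (z₁ t)| ≤ |g (z₁ s)| := by
  rw [← sq_le_sq]
  refine h.le_of_deriv hs hst ht (Φ := fun r => g (z₁ r) ^ 2)
    ((h.ac_profile hg hs hst ht).comp_deriv (φ := fun y => y ^ 2) (φ' := fun y => 2 * y) (S := univ)
      (fun x _ => by simpa using hasDerivAt_pow 2 x) (by fun_prop) fun _ _ => mem_univ _) ?_
  intro r hr v h1 _ _ _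
  refine ⟨_, ?_, ((hg.hasDerivAt _).comp r h1).pow 2⟩
  have hκ := h.rate_pos r ⟨hs.trans hr.1.le, hr.2.trans ht⟩
  have h2 := (two_mul_sq_eq_of_switch_eq_zero (h.switch_eq_zero hg hc hce hs hr.1.le (hr.2.trans ht) hp)).2
  have h3 : κ r * g' (z₁ r) * (g (z₁ r) * z₂ r) ≤ 0 :=
    mul_nonpos_of_nonneg_of_nonpos (mul_pos hκ (hg.deriv_pos _)).le h2
  simp only [Function.comp]
  norm_num
  nlinarith

/-- The energy controls g(z₁) from above and the positive part of z₂. The missing sides come from P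
≥ 0: it bounds 2z₂² by g(z₁) when z₂ ≤ 0, and -g(z₁) by 2z₂² when z₂ ≥ 0. -/
theorem bound_of_switch_nonneg {t : ℝ} (hat : a ≤ t) (ht : t < b)
    (hp : ∀ r ∈ Ico a t, 0 < switchFun g (z₁ r) (z₂ r))
    (hpt : 0 ≤ switchFun g (z₁ t) (z₂ t)) :
    |g (z₁ t)| ≤ |g (z₁ a)| + 2 * z₂ a ^ 2 ∧ 2 * z₂ t ^ 2 ≤ |g (z₁ a)| + 2 * z₂ a ^ 2 := by
  have h1 := h.snd_antitone hg hc le_rfl hat ht hp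
  have h2 := h.energy_le hg hc le_rfl hat ht hp
  have h3 : max (z₂ a) 0 ^ 2 ≤ z₂ a ^ 2 := by
    rw [← sq_abs (z₂ a)]
    exact pow_le_pow_left₀ (le_max_right _ _) (max_le (le_abs_self _) (abs_nonneg _)) 2
  have h3' : max (z₂ t) 0 ^ 2 ≤ max (z₂ a) 0 ^ 2 :=
    pow_le_pow_left₀ (le_max_right _ _) (max_le_max_right 0 h1) 2
  have h4 := le_abs_self (g (z₁ a))
  have h4' := abs_nonneg (g (z₁ a))
  have h5 := sq_nonneg (max (z₂ t) 0)
  unfold switchFun at hpt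
  rcases le_total (z₂ t) 0 with hz | hz
  · rw [abs_of_nonpos hz] at hpt
    rw [max_eq_right hz] at h2
    refine ⟨?_, by nlinarith⟩
    rw [abs_le]
    constructor <;> nlinarith
  · rw [abs_of_nonneg hz] at hpt
    rw [max_eq_left hz] at h2 h3'
    refine ⟨?_, by nlinarith⟩
    rw [abs_le]
    constructor <;> nlinarith

theorem bound_of_switch_nonneg_start (hce : ∀ x, c (-x) = c x) {t : ℝ} (hat : a ≤ t) (ht : t < b)
    (hpa : 0 ≤ switchFun g (z₁ a) (z₂ a)) :
    |g (z₁ t)| ≤ |g (z₁ a)| + 2 * z₂ a ^ 2 ∧ 2 * z₂ t ^ 2 ≤ |g (z₁ a)| + 2 * z₂ a ^ 2 := by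
  rcases lt_or_ge 0 (switchFun g (z₁ t) (z₂ t)) with hpt | hpt
  · exact h.bound_of_switch_nonneg hg hc hat ht
      (fun r hr => (h.switch_pos_of_le hg hc hr.1 hr.2.le ht hpt).1) hpt.le
  · obtain ⟨m, hm, hm0, hmb⟩ : ∃ m ∈ Icc a t, switchFun g (z₁ m) (z₂ m) = 0 ∧
        |g (z₁ m)| ≤ |g (z₁ a)| + 2 * z₂ a ^ 2 := by
      rcases hpa.eq_or_lt with h0 | h0
      · exact ⟨a, left_mem_Icc.2 hat, h0.symm, by nlinarith [sq_nonneg (z₂ a)]⟩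
      · obtain ⟨m, hm, hm0, hlt⟩ := h.exists_first_zero hg hat ht h0 hpt
        exact ⟨m, ⟨hm.1.le, hm.2⟩, hm0, (h.bound_of_switch_nonneg hg hc hm.1.le
          (hm.2.trans_lt ht) hlt hm0.ge).1⟩
    have h1 := h.sliding_abs_le hg hc hce hm.1 hm.2 ht hm0
    have h2 := (two_mul_sq_eq_of_switch_eq_zero (h.switch_eq_zero hg hc hce hm.1 hm.2 ht hm0)).1
    exact ⟨h1.trans hmb, h2.le.trans (h1.trans hmb)⟩

/-- Uniform bound of the flow by its initial state. -/
theorem bound (hce : ∀ x, c (-x) = c x) {t : ℝ} (hat : a ≤ t) (ht : t < b) :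
    |g (z₁ t)| ≤ |g (z₁ a)| + 2 * z₂ a ^ 2 ∧ 2 * z₂ t ^ 2 ≤ |g (z₁ a)| + 2 * z₂ a ^ 2 := by
  rcases le_total 0 (switchFun g (z₁ a) (z₂ a)) with hpa | hpa
  · exact h.bound_of_switch_nonneg_start hg hc hce hat ht hpa
  · have := (h.neg hg hce).bound_of_switch_nonneg_start hg hc hce hat ht
      (by simp only [hg.switchFun_neg]; linarith)
    simpa only [hg.odd, abs_neg, neg_sq] using this

theorem eq_zero_of_eq_zero (hce : ∀ x, c (-x) = c x) {s t : ℝ} (hs : a ≤ s) (hst : s ≤ t)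
    (ht : t < b) (h1 : z₁ s = 0) (h2 : z₂ s = 0) : z₁ t = 0 ∧ z₂ t = 0 := by
  have := (h.tail ⟨hs, hst.trans_lt ht⟩).bound hg hc hce hst ht
  simp only [h1, h2, hg.zero, abs_zero] at this
  refine ⟨hg.eq_zero_of_abs_le_zero (by linarith [this.1]), ?_⟩
  nlinarith [this.2, sq_nonneg (z₂ t)]

end

end ReachingFlow

/-! ### Travel-time integrals -/

/-- Reciprocal speed at position `x` on the energy level `w` above the sliding surface. -/
def slowness (g : ℝ → ℝ) (w x : ℝ) : ℝ := (Real.sqrt (|g x| / 2 + w))⁻¹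

/-- Travel time from `0` to `z`; `w = 0` is the travel time on the sliding surface. -/
def travelTime (g : ℝ → ℝ) (w z : ℝ) : ℝ := ∫ x in (0:ℝ)..z, slowness g w x

/-- Time needed by the reaching law `σ' = -c(σ)` from `s` to `0`. -/
def reachTime (c : ℝ → ℝ) (s : ℝ) : ℝ := ∫ x in (0:ℝ)..s, (c x)⁻¹

theorem intervalIntegrable_of_integrableOn_Ioi {f : ℝ → ℝ} (hf : IntegrableOn f (Ioi 0)) {x y : ℝ}
    (hx : 0 ≤ x) (hy : 0 ≤ y) : IntervalIntegrable f volume x y := by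
  rw [intervalIntegrable_iff]
  refine hf.mono_set fun r hr => ?_
  exact lt_of_le_of_lt (le_min hx hy) hr.1

theorem reachTime_le {c : ℝ → ℝ} {T : ℝ} (hc : ∀ x, 0 ≤ c x)
    (hi : IntegrableOn (fun x => (c x)⁻¹) (Ioi 0)) (hT : ∫ x in Ioi (0:ℝ), (c x)⁻¹ = T) {s : ℝ}
    (hs : 0 ≤ s) : reachTime c s ≤ T := by
  rw [reachTime, intervalIntegral.integral_of_le hs, ← hT]
  exact setIntegral_mono_set hi (Eventually.of_forall fun x => inv_nonneg.2 (hc x))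
    (Eventually.of_forall Ioc_subset_Ioi_self)

theorem reachTime_nonneg {c : ℝ → ℝ} (hc : ∀ x, 0 ≤ c x) {s : ℝ} (hs : 0 ≤ s) :
    0 ≤ reachTime c s :=
  intervalIntegral.integral_nonneg hs fun x _ => inv_nonneg.2 (hc x)

theorem hasDerivAt_reachTime {c : ℝ → ℝ} (hcp : ∀ x, 0 < x → 0 < c x)
    (hcc : ContinuousOn c (Ioi 0)) (hi : IntegrableOn (fun x => (c x)⁻¹) (Ioi 0)) {s : ℝ}
    (hs : 0 < s) : HasDerivAt (reachTime c) (c s)⁻¹ s := by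
  have hcont : ContinuousOn (fun x => (c x)⁻¹) (Ioi 0) := hcc.inv₀ fun x hx => (hcp x hx).ne'
  exact intervalIntegral.integral_hasDerivAt_right
    (intervalIntegrable_of_integrableOn_Ioi hi le_rfl hs.le)
    (hcont.stronglyMeasurableAtFilter isOpen_Ioi s hs)
    (hcont.continuousAt (Ioi_mem_nhds hs))

namespace OddProfile
variable {g g' : ℝ → ℝ} (hg : OddProfile g g')
include hg

omit hg in
theorem slowness_nonneg (w x : ℝ) : 0 ≤ slowness g w x := inv_nonneg.2 (Real.sqrt_nonneg _)

theorem level_pos {w x : ℝ} (hw : 0 ≤ w) (h : 0 < w ∨ 0 < x) : 0 < |g x| / 2 + w := by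
  rcases h with h | h
  · have := abs_nonneg (g x); linarith
  · have := abs_pos.2 (hg.pos h).ne'; linarith

theorem slowness_anti {w x : ℝ} (hw : 0 ≤ w) (hx : 0 < x) : slowness g w x ≤ slowness g 0 x := by
  unfold slowness
  have := hg.level_pos le_rfl (Or.inr hx)
  gcongr

theorem continuousOn_slowness {w : ℝ} {S : Set ℝ} (hw : 0 ≤ w) (h : ∀ x ∈ S, 0 < w ∨ 0 < x) :
    ContinuousOn (slowness g w) S := by
  have := hg.continuous
  refine ContinuousOn.inv₀ (by fun_prop) fun x hx => ?_
  exact (Real.sqrt_pos.2 (hg.level_pos hw (h x hx))).ne'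

theorem integrableOn_slowness (hi : IntegrableOn (slowness g 0) (Ioi 0)) {w : ℝ} (hw : 0 ≤ w) :
    IntegrableOn (slowness g w) (Ioi 0) := by
  refine Integrable.mono' hi ((hg.continuousOn_slowness hw fun x hx =>
    Or.inr hx).aestronglyMeasurable measurableSet_Ioi) ?_
  filter_upwards [ae_restrict_mem measurableSet_Ioi] with x hx
  rw [Real.norm_of_nonneg (OddProfile.slowness_nonneg (g := g) w x)]
  exact hg.slowness_anti hw hx

theorem hasDerivAt_travelTime (hi : IntegrableOn (slowness g 0) (Ioi 0)) {w z : ℝ} (hw : 0 ≤ w)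
    (h : 0 < w ∨ 0 < z) : HasDerivAt (travelTime g w) (slowness g w z) z := by
  rcases h with h | h
  · have hcont : Continuous (slowness g w) :=
      continuousOn_univ.1 (hg.continuousOn_slowness hw fun x _ => Or.inl h)
    exact intervalIntegral.integral_hasDerivAt_right (hcont.intervalIntegrable _ _)
      (hcont.stronglyMeasurableAtFilter _ _) hcont.continuousAt
  · have hcont : ContinuousOn (slowness g w) (Ioi 0) :=
      hg.continuousOn_slowness hw fun x hx => Or.inr hx
    exact intervalIntegral.integral_hasDerivAt_right
      (intervalIntegrable_of_integrableOn_Ioi (hg.integrableOn_slowness hi hw) le_rfl h.le)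
      (hcont.stronglyMeasurableAtFilter isOpen_Ioi z h) (hcont.continuousAt (Ioi_mem_nhds h))

omit hg in
theorem travelTime_nonneg (w : ℝ) {z : ℝ} (hz : 0 ≤ z) : 0 ≤ travelTime g w z :=
  intervalIntegral.integral_nonneg hz fun x _ => OddProfile.slowness_nonneg (g := g) w x

theorem travelTime_sub (hi : IntegrableOn (slowness g 0) (Ioi 0)) {w y z : ℝ} (hw : 0 ≤ w)
    (hy : 0 ≤ y) (hz : 0 ≤ z) :
    travelTime g w z - travelTime g w y = ∫ x in y..z, slowness g w x := by
  have := hg.integrableOn_slowness hi hw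
  exact intervalIntegral.integral_interval_sub_left
    (intervalIntegrable_of_integrableOn_Ioi this le_rfl hz)
    (intervalIntegrable_of_integrableOn_Ioi this le_rfl hy)

theorem travelTime_mono (hi : IntegrableOn (slowness g 0) (Ioi 0)) {w y z : ℝ} (hw : 0 ≤ w)
    (hy : 0 ≤ y) (hyz : y ≤ z) : travelTime g w y ≤ travelTime g w z := by
  have h1 := hg.travelTime_sub hi hw hy (hy.trans hyz)
  have h2 : 0 ≤ ∫ x in y..z, slowness g w x :=
    intervalIntegral.integral_nonneg hyz fun x _ => OddProfile.slowness_nonneg (g := g) w x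
  linarith

/-- The time gained on the level `w` over the sliding surface grows with the distance. -/
theorem travelTime_gain_mono (hi : IntegrableOn (slowness g 0) (Ioi 0)) {w y z : ℝ} (hw : 0 ≤ w)
    (hy : 0 ≤ y) (hyz : y ≤ z) :
    travelTime g 0 y - travelTime g w y ≤ travelTime g 0 z - travelTime g w z := by
  have h1 := hg.travelTime_sub hi hw hy (hy.trans hyz)
  have h2 := hg.travelTime_sub hi le_rfl hy (hy.trans hyz)
  have h3 : ∫ x in y..z, slowness g w x ≤ ∫ x in y..z, slowness g 0 x := by
    rw [intervalIntegral.integral_of_le hyz, intervalIntegral.integral_of_le hyz]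
    have hs : Ioc y z ⊆ Ioi 0 := fun r hr => hy.trans_lt hr.1
    refine setIntegral_mono_on ((hg.integrableOn_slowness hi hw).mono_set hs) (hi.mono_set hs)
      measurableSet_Ioc fun x hx => hg.slowness_anti hw (hs hx)
  linarith

theorem travelTime_le (hi : IntegrableOn (slowness g 0) (Ioi 0)) {w z : ℝ} (hw : 0 ≤ w)
    (hz : 0 ≤ z) : travelTime g w z ≤ travelTime g 0 z := by
  have := hg.travelTime_gain_mono hi hw le_rfl hz
  simp only [travelTime, intervalIntegral.integral_same] at this ⊢
  linarith

/-- Strict because the slowness is positive on (z, z + 1). This gap is what makes the arrival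
precede the end of the horizon. -/
theorem travelTime_lt (hi : IntegrableOn (slowness g 0) (Ioi 0)) {z T : ℝ} (hz : 0 ≤ z)
    (hT : ∫ x in Ioi (0:ℝ), slowness g 0 x = T) : travelTime g 0 z < T := by
  have h1 : travelTime g 0 (z + 1) ≤ T := by
    rw [travelTime, intervalIntegral.integral_of_le (by linarith), ← hT]
    exact setIntegral_mono_set hi (Eventually.of_forall fun x => OddProfile.slowness_nonneg (g := g) 0 x)
      (Eventually.of_forall Ioc_subset_Ioi_self)
  have h2 := hg.travelTime_sub hi le_rfl hz (show 0 ≤ z + 1 by linarith)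
  have h3 : 0 < ∫ x in z..(z + 1), slowness g 0 x := by
    refine intervalIntegral.intervalIntegral_pos_of_pos_on
      (intervalIntegrable_of_integrableOn_Ioi hi hz (by linarith)) (fun x hx => ?_) (by linarith)
    exact inv_pos.2 (Real.sqrt_pos.2 (hg.level_pos le_rfl (Or.inr (hz.trans_lt hx.1))))
  linarith

end OddProfile

/-! ### Clock estimates for the approach, reaching and sliding legs -/

namespace ReachingFlow
variable {g g' c κ z₁ z₂ τ : ℝ → ℝ} {a b : ℝ}

section
variable (hg : OddProfile g g') (h : ReachingFlow g g' c κ z₁ z₂ a b)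
  (hτ : ∀ t ∈ Ico a b, HasDerivAt τ (κ t) t) (hκ : ContinuousOn κ (Ico a b))
  (hi : IntegrableOn (slowness g 0) (Ioi 0))
include hg h hτ hκ hi

omit hg h hi in
theorem ac_clock {s t : ℝ} (hs : a ≤ s) (hst : s ≤ t) (ht : t < b) :
    AbsolutelyContinuousOnInterval τ s t := by
  have hsub : uIcc s t ⊆ Ico a b := by
    rw [uIcc_of_le hst]; exact fun r hr => ⟨hs.trans hr.1, hr.2.trans_lt ht⟩
  exact absolutelyContinuousOnInterval_of_hasDerivAt (fun r hr => hτ r (hsub hr)) (hκ.mono hsub)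

/-- Approach of the line `z₁ = 0` from the left, on or above the sliding surface. -/
theorem clock_le_travel {w s t : ℝ} (hw : 0 ≤ w) (hs : a ≤ s) (hst : s ≤ t) (ht : t < b)
    (hz : ∀ r ∈ Icc s t, z₁ r ≤ 0 ∧ 0 ≤ z₂ r ∧ (0 < w ∨ z₁ r < 0))
    (hp : ∀ r ∈ Icc s t, 2 * w ≤ switchFun g (z₁ r) (z₂ r)) :
    τ t - τ s ≤ travelTime g w (-z₁ s) - travelTime g w (-z₁ t) := by
  have hpos : ∀ r ∈ Icc s t, 0 < w ∨ 0 < -z₁ r := fun r hr => by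
    rcases (hz r hr).2.2 with h1 | h1
    · exact Or.inl h1
    · exact Or.inr (by linarith)
  have key := h.le_of_deriv hs hst ht (Φ := fun r => travelTime g w (-z₁ r) + τ r) (
    AbsolutelyContinuousOnInterval.add
    ((h.ac_fst_Icc hs hst ht).neg.comp_deriv (φ := travelTime g w) (φ' := slowness g w)
      (S := {x | 0 < w ∨ 0 < x}) (fun x hx => hg.hasDerivAt_travelTime hi hw hx)
      (hg.continuousOn_slowness hw fun x hx => hx)
      (by rw [uIcc_of_le hst]; exact hpos)) (ac_clock hτ hκ hs hst ht)) ?_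
  · linarith
  intro r hr v h1 _ _ _
  have hr' : r ∈ Icc s t := ⟨hr.1.le, hr.2.le⟩
  have hrb : r ∈ Ico a b := ⟨hs.trans hr.1.le, hr.2.trans ht⟩
  have h1n : HasDerivAt (fun r => -z₁ r) (-(κ r * z₂ r)) r := h1.neg
  have dT := (hg.hasDerivAt_travelTime hi hw (z := -z₁ r) (hpos r hr')).comp r h1n
  refine ⟨_, ?_, dT.add (hτ r hrb)⟩
  have hκ0 := h.rate_pos r hrb
  obtain ⟨hz1, hz2, _⟩ := hz r hr'
  have hlev := hg.level_pos hw (hpos r hr')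
  rw [hg.odd, abs_neg, abs_of_nonpos (hg.nonpos hz1)] at hlev
  have h2 : Real.sqrt (-g (z₁ r) / 2 + w) ≤ z₂ r := by
    apply Real.sqrt_le_iff.2 ⟨hz2, ?_⟩
    have := hp r hr'
    unfold switchFun at this
    rw [abs_of_nonneg hz2] at this
    nlinarith
  have h3 : slowness g w (-z₁ r) * z₂ r ≥ 1 := by
    rw [slowness, hg.odd, abs_neg, abs_of_nonpos (hg.nonpos hz1), ge_iff_le, inv_mul_eq_div,
      one_le_div (Real.sqrt_pos.2 hlev)]
    exact h2
  nlinarith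

/-- Time spent on the sliding surface. -/
theorem clock_le_sliding (hc : ∀ x, 0 ≤ c x) (hce : ∀ x, c (-x) = c x) {s t : ℝ} (hs : a ≤ s)
    (hst : s ≤ t) (ht : t < b) (hp : switchFun g (z₁ s) (z₂ s) = 0)
    (hz : ¬(z₁ t = 0 ∧ z₂ t = 0)) :
    τ t - τ s ≤ travelTime g 0 |z₁ s| := by
  have hP : ∀ r ∈ Icc s t, switchFun g (z₁ r) (z₂ r) = 0 := fun r hr =>
    h.switch_eq_zero hg hc hce hs hr.1 (hr.2.trans_lt ht) hp
  -- On the surface z₁ = 0 forces z₂ = 0, and the origin is absorbing; so z₁ keeps its sign until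
  -- the origin is reached.
  have hne : ∀ r ∈ Icc s t, z₁ r ≠ 0 := fun r hr h0 => by
    have h2 := (two_mul_sq_eq_of_switch_eq_zero (hP r hr)).1
    rw [h0, hg.zero, abs_zero] at h2
    have h3 : z₂ r = 0 := by nlinarith
    exact hz (h.eq_zero_of_eq_zero hg hc hce (hs.trans hr.1) hr.2 ht h0 h3)
  wlog hneg : z₁ s < 0 generalizing z₁ z₂
  · have := this (h.neg hg hce) (by simp only [hg.switchFun_neg, hp, neg_zero])
      (by simpa using hz) (fun r hr => by simp only [hg.switchFun_neg, hP r hr, neg_zero])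
      (fun r hr => by simpa using hne r hr) (by
        have h1 := lt_of_le_of_ne (not_lt.1 hneg) (hne s (left_mem_Icc.2 hst)).symm
        simpa using h1)
    simpa using this
  have hneg' : ∀ r ∈ Icc s t, z₁ r < 0 := fun r hr => by
    by_contra hcon
    have hcont := h.continuousOn_fst hs hr.1 (hr.2.trans_lt ht)
    obtain ⟨m, hm, hm0⟩ := intermediate_value_Icc hr.1 hcont ⟨hneg.le, not_lt.1 hcon⟩
    exact hne m ⟨hm.1, hm.2.trans hr.2⟩ hm0
  have key := h.clock_le_travel hg hτ hκ hi le_rfl hs hst ht (fun r hr => by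
    refine ⟨(hneg' r hr).le, ?_, Or.inr (hneg' r hr)⟩
    have h2 := (two_mul_sq_eq_of_switch_eq_zero (hP r hr)).2
    exact nonneg_of_mul_nonneg_right (by linarith : 0 ≤ (-g (z₁ r)) * z₂ r)
      (by have := hg.neg (hneg' r hr); linarith)) (fun r hr => by rw [hP r hr]; simp)
  rw [abs_of_neg hneg]
  have := OddProfile.travelTime_nonneg (g := g) 0 (z := -z₁ t) (by linarith [hneg' t (right_mem_Icc.2 hst)])
  linarith

omit hτ hκ hi in
-- While P > 0, z₂ decreases, so its nonnegative final value bounds it below throughout and z₁ can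
-- only have increased. Hence a flow now at z₁ ≤ 0 with z₂ ≥ 0 has been in the left half plane since
-- s.
theorem left_half {s t : ℝ} (hc : ∀ x, 0 ≤ c x) (hs : a ≤ s) (ht : t < b)
    (hp : ∀ r ∈ Ico s t, 0 < switchFun g (z₁ r) (z₂ r))
    (hz2 : 0 ≤ z₂ t) : ∀ r ∈ Icc s t, z₁ r ≤ z₁ t ∧ z₂ t ≤ z₂ r := by
  have h2 : ∀ r ∈ Icc s t, z₂ t ≤ z₂ r := fun r hr =>
    h.snd_antitone hg hc (hs.trans hr.1) hr.2 ht fun x hx => hp x ⟨hr.1.trans hx.1, hx.2⟩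
  refine fun r hr => ⟨h.fst_monotone (hs.trans hr.1) hr.2 ht fun x hx => ?_, h2 r hr⟩
  exact hz2.trans (h2 x ⟨hr.1.trans hx.1.le, hx.2.le⟩)

omit h hτ hκ hi in
theorem snd_nonneg_of_switch_nonneg {x y : ℝ} (hx : x ≤ 0) (hp : 0 ≤ switchFun g x y) : 0 ≤ y := by
  by_contra hy
  have hy' := not_le.1 hy
  unfold switchFun at hp
  have h1 := hg.nonpos hx
  have h2 := mul_neg_of_neg_of_pos hy' (abs_pos.2 hy'.ne)
  linarith

variable (hc : ∀ x, 0 ≤ c x) (hcp : ∀ x, 0 < x → 0 < c x) (hcc : ContinuousOn c (Ioi 0))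
  (hic : IntegrableOn (fun x => (c x)⁻¹) (Ioi 0))
include hc hcp hcc hic

omit h hτ hκ hi hc hcc hic in
/-- Decay of the reaching potential in the right half plane. -/
theorem potential_deriv_nonpos {x y v w k : ℝ} (hk : 0 < k) (hx : 0 ≤ x)
    (hp : 0 < switchFun g x y) (hw : switchFun g x y ≤ 2 * w)
    (hv : v ≤ -(c (slideVar g x y) + g' x / 4)) :
    (c (slideVar g x y))⁻¹ * (k * v + (2 * |y| * (k * v) + g' x * (k * y)) /
      (2 * Real.sqrt (y * |y| + g x))) + slowness g w x * (k * y) + k ≤ 0 := by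
  have hσ := OddProfile.slideVar_pos hp
  have hC := hcp _ hσ
  have hgp := hg.deriv_pos x
  have hgx := hg.nonneg hx
  set C := c (slideVar g x y)
  have hφ : 0 < y * |y| + g x := by
    unfold switchFun at hp
    rcases le_total 0 y with hy | hy
    · rw [abs_of_nonneg hy] at hp ⊢
      nlinarith
    · rw [abs_of_nonpos hy] at hp ⊢
      nlinarith
  set r := Real.sqrt (y * |y| + g x) with hr
  have hrpos : 0 < r := Real.sqrt_pos.2 hφ
  have hr2 : r ^ 2 = y * |y| + g x := Real.sq_sqrt hφ.le
  have hslow : slowness g w x * y ≤ |y| / r := by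
    rcases le_total y 0 with hy | hy
    · exact (mul_nonpos_of_nonneg_of_nonpos (OddProfile.slowness_nonneg (g := g) w x) hy).trans (by positivity)
    · rw [slowness, inv_mul_eq_div, abs_of_nonneg hy]
      have : r ≤ Real.sqrt (|g x| / 2 + w) := by
        apply Real.sqrt_le_sqrt
        rw [abs_of_nonneg hgx, abs_of_nonneg hy]
        unfold switchFun at hw
        rw [abs_of_nonneg hy] at hw
        linarith
      gcongr
  -- Exactly the inequality by which the g'/4 part of the input absorbs the drift g'y/(2r) of σ. It
  -- uses x ≥ 0: for y ≥ 0 it says y² ≤ y² + g(x).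
  have hyr : 2 * y - |y| ≤ r := by
    rcases le_total y 0 with hy | hy
    · have := abs_nonneg y; linarith
    · rw [abs_of_nonneg hy]
      have : y ≤ r := by
        apply Real.le_sqrt_of_sq_le
        rw [abs_of_nonneg hy]; nlinarith
      linarith
  have hmain : v + (2 * |y| * v + g' x * y) / (2 * r) ≤ -C * (1 + |y| / r) := by
    have e : v + (2 * |y| * v + g' x * y) / (2 * r) =
        v * (1 + |y| / r) + g' x * y / (2 * r) := by field_simp; ring
    have h1 : v * (1 + |y| / r) ≤ -(C + g' x / 4) * (1 + |y| / r) := by gcongr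
    have h2 : g' x * y / (2 * r) ≤ g' x / 4 * (1 + |y| / r) := by
      have : g' x / 4 * (1 + |y| / r) - g' x * y / (2 * r) =
          g' x / (4 * r) * (r - (2 * y - |y|)) := by field_simp; ring
      have h3 : 0 ≤ g' x / (4 * r) * (r - (2 * y - |y|)) :=
        mul_nonneg (by positivity) (by linarith)
      linarith
    rw [e]
    linarith
  have hfin : C⁻¹ * (v + (2 * |y| * v + g' x * y) / (2 * r)) ≤ -(1 + |y| / r) := by
    have := mul_le_mul_of_nonneg_left hmain (inv_nonneg.2 hC.le)
    have e : C⁻¹ * (-C * (1 + |y| / r)) = -(1 + |y| / r) := by field_simp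
    linarith
  have e : C⁻¹ * (k * v + (2 * |y| * (k * v) + g' x * (k * y)) / (2 * r)) +
      slowness g w x * (k * y) + k =
      k * (C⁻¹ * (v + (2 * |y| * v + g' x * y) / (2 * r)) + slowness g w x * y + 1) := by
    field_simp
  rw [e]
  exact mul_nonpos_of_nonneg_of_nonpos hk.le (by linarith)

/-- Reaching phase in the right half plane. -/
theorem clock_le_reaching {s t w : ℝ} (hs : a ≤ s) (hst : s ≤ t) (ht : t < b)
    (hz1 : ∀ r ∈ Icc s t, 0 ≤ z₁ r) (hp : ∀ r ∈ Icc s t, 0 < switchFun g (z₁ r) (z₂ r))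
    (hw0 : 0 < w) (hw : switchFun g (z₁ s) (z₂ s) ≤ 2 * w) :
    τ t - τ s ≤ reachTime c (slideVar g (z₁ s) (z₂ s)) + travelTime g w (z₁ s) -
      travelTime g w (z₁ t) := by
  -- Twice the radicand is P + g(z₁), positive in the right half plane, so the root in σ is
  -- differentiable along this leg.
  have hφ : ∀ r ∈ Icc s t, 0 < z₂ r * |z₂ r| + g (z₁ r) := fun r hr => by
    have h1 := hp r hr
    have h2 := hg.nonneg (hz1 r hr)
    unfold switchFun at h1
    rcases le_total 0 (z₂ r) with hy | hy
    · rw [abs_of_nonneg hy] at h1 ⊢; nlinarith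
    · rw [abs_of_nonpos hy] at h1 ⊢; nlinarith
  set σ : ℝ → ℝ := fun r => z₂ r + Real.sqrt (z₂ r * |z₂ r| + g (z₁ r)) with hσ
  have hσe : ∀ r ∈ Icc s t, σ r = slideVar g (z₁ r) (z₂ r) := fun r hr => by
    simp only [hσ, slideVar, Real.sqrt_eq_zero_of_nonpos (neg_nonpos.2 (hφ r hr).le), sub_zero]
  have hacφ : AbsolutelyContinuousOnInterval (fun r => z₂ r * |z₂ r| + g (z₁ r)) s t :=
    ((h.ac_snd_Icc hs hst ht).comp_deriv (S := univ) (fun x _ => hasDerivAt_mul_abs_self x)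
      (by fun_prop) fun _ _ => mem_univ _).add (h.ac_profile hg hs hst ht)
  have hacσ : AbsolutelyContinuousOnInterval σ s t :=
    (h.ac_snd_Icc hs hst ht).add (hacφ.comp_deriv (φ := Real.sqrt)
      (φ' := fun x => 1 / (2 * Real.sqrt x)) (S := Ioi 0)
      (fun x hx => Real.hasDerivAt_sqrt (ne_of_gt hx))
      (continuousOn_const.div (by fun_prop) fun x hx => by
        have := Real.sqrt_pos.2 hx; positivity)
      (by rw [uIcc_of_le hst]; exact hφ))
  have hacF : AbsolutelyContinuousOnInterval (fun r => reachTime c (σ r)) s t :=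
    hacσ.comp_deriv (φ := reachTime c) (φ' := fun x => (c x)⁻¹) (S := Ioi 0)
      (fun x hx => hasDerivAt_reachTime hcp hcc hic hx) (hcc.inv₀ fun x hx => (hcp x hx).ne')
      (by
        rw [uIcc_of_le hst]
        intro r hr
        rw [hσe r hr]
        exact OddProfile.slideVar_pos (hp r hr))
  have hacT : AbsolutelyContinuousOnInterval (fun r => travelTime g w (z₁ r)) s t :=
    (h.ac_fst_Icc hs hst ht).comp_deriv (φ := travelTime g w) (φ' := slowness g w) (S := univ)
      (fun x _ => hg.hasDerivAt_travelTime hi hw0.le (Or.inl hw0))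
      (hg.continuousOn_slowness hw0.le fun x _ => Or.inl hw0) fun _ _ => mem_univ _
  have key := h.le_of_deriv hs hst ht
    (Φ := fun r => reachTime c (σ r) + travelTime g w (z₁ r) + τ r)
    ((hacF.add hacT).add (ac_clock hτ hκ hs hst ht)) ?_
  · have h1 : 0 ≤ reachTime c (σ t) := by
      rw [hσe t (right_mem_Icc.2 hst)]
      exact reachTime_nonneg hc (OddProfile.slideVar_pos (hp t (right_mem_Icc.2 hst))).le
    rw [← hσe s (left_mem_Icc.2 hst)]
    linarith [key]
  intro r hr v h1 h2 h3 _
  have hr' : r ∈ Icc s t := ⟨hr.1.le, hr.2.le⟩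
  have hrb : r ∈ Ico a b := ⟨hs.trans hr.1.le, hr.2.trans ht⟩
  have dφ := ((hasDerivAt_mul_abs_self (z₂ r)).comp r h2).add ((hg.hasDerivAt (z₁ r)).comp r h1)
  have dσ : HasDerivAt σ _ r := h2.add (dφ.sqrt (hφ r hr').ne')
  have hσr : 0 < σ r := by rw [hσe r hr']; exact OddProfile.slideVar_pos (hp r hr')
  have dF := (hasDerivAt_reachTime hcp hcc hic hσr).comp r dσ
  have dT := (hg.hasDerivAt_travelTime hi hw0.le (z := z₁ r) (Or.inl hw0)).comp r h1
  refine ⟨_, ?_, (dF.add dT).add (hτ r hrb)⟩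
  have hPw := (h.switch_pos_of_le hg hc hs hr.1.le (hr.2.trans ht) (hp r hr')).2.trans hw
  have := potential_deriv_nonpos hg hcp (h.rate_pos r hrb) (hz1 r hr') (hp r hr') hPw
    (h3 (hp r hr'))
  rw [hσe r hr']
  simpa using this

variable {T : ℝ} (hT : ∫ x in Ioi (0:ℝ), (c x)⁻¹ = T)
include hT

/-- Reaching phase that ends in the right half plane, the end point being possibly on the sliding
surface. -/
theorem exists_clock_le {t : ℝ} (hat : a < t) (ht : t < b)
    (hp : ∀ r ∈ Ico a t, 0 < switchFun g (z₁ r) (z₂ r)) (hz : 0 < z₁ t) :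
    ∃ w, 0 < w ∧ τ t - τ a ≤ travelTime g w |z₁ a| + T - travelTime g w (z₁ t) := by
  -- P may vanish at t, where the potential estimate is unavailable. It is applied on [s, r] with r
  -- < t, then r tends to t by continuity; w > 0 makes `travelTime g w` continuous across z₁ = 0.
  have hright : ∀ s ∈ Ico a t, 0 ≤ z₁ s → τ t - τ s ≤ T +
      travelTime g (switchFun g (z₁ s) (z₂ s) / 2) (z₁ s) -
      travelTime g (switchFun g (z₁ s) (z₂ s) / 2) (z₁ t) := by
    intro s hs hz1
    set w := switchFun g (z₁ s) (z₂ s) / 2 with hw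
    have hw0 : 0 < w := by have := hp s hs; positivity
    have hbd : ∀ r ∈ Ico s t, τ r - τ s + travelTime g w (z₁ r) ≤ T + travelTime g w (z₁ s) := by
      intro r hr
      -- There is no return to the left half plane: by `left_half`, z₁ < 0 at x would force z₁ < 0
      -- already at s.
      have hz' : ∀ x ∈ Icc s r, 0 ≤ z₁ x := fun x hx => by
        by_contra hcon
        have hx' := not_le.1 hcon
        have hxa : x ∈ Ico a t := ⟨hs.1.trans hx.1, hx.2.trans_lt hr.2⟩
        have h2 := snd_nonneg_of_switch_nonneg hg hx'.le (hp x hxa).le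
        have := (h.left_half hg hc hs.1 (hxa.2.trans ht)
          (fun y hy => hp y ⟨hs.1.trans hy.1, hy.2.trans hxa.2⟩) h2 s (left_mem_Icc.2 hx.1)).1
        linarith
      have h1 := h.clock_le_reaching hg hτ hκ hi hc hcp hcc hic hs.1 hr.1 (hr.2.trans ht) hz'
        (fun x hx => hp x ⟨hs.1.trans hx.1, hx.2.trans_lt hr.2⟩) hw0 (by rw [hw]; linarith)
      have h2 := reachTime_le hc hic hT (OddProfile.slideVar_pos (hp s hs)).le
      linarith
    have hcl : t ∈ closure (Ico s t) := by
      rw [closure_Ico hs.2.ne]; exact right_mem_Icc.2 hs.2.le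
    have hc1 : ContinuousWithinAt z₁ (Ico s t) t :=
      ((h.continuousOn_fst hs.1 hs.2.le ht) t (right_mem_Icc.2 hs.2.le)).mono
        Ico_subset_Icc_self
    have hc2 : ContinuousWithinAt τ (Ico s t) t :=
      (hτ t ⟨hat.le, ht⟩).continuousAt.continuousWithinAt
    have hc3 : ContinuousWithinAt (fun r => travelTime g w (z₁ r)) (Ico s t) t :=
      (hg.hasDerivAt_travelTime hi hw0.le (Or.inl hw0)).continuousAt.comp_continuousWithinAt hc1
    have := ContinuousWithinAt.closure_le hcl
      ((hc2.sub continuousWithinAt_const).add hc3) continuousWithinAt_const hbd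
    simp only [Pi.add_apply, Pi.sub_apply] at this
    linarith
  rcases le_or_gt 0 (z₁ a) with hz0 | hz0
  · have h0 := hp a ⟨le_rfl, hat⟩
    refine ⟨switchFun g (z₁ a) (z₂ a) / 2, by positivity, ?_⟩
    rw [abs_of_nonneg hz0]
    have := hright a ⟨le_rfl, hat⟩ hz0
    linarith
  · obtain ⟨m, hm, hm0⟩ := intermediate_value_Icc hat.le (h.continuousOn_fst le_rfl hat.le ht)
      ⟨hz0.le, hz.le⟩
    have hmt : m < t := lt_of_le_of_ne hm.2 fun heq => by rw [heq] at hm0; linarith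
    have hPm := hp m ⟨hm.1, hmt⟩
    have h2m := snd_nonneg_of_switch_nonneg hg hm0.le hPm.le
    have hl := h.left_half hg hc le_rfl (hmt.trans ht)
      (fun y hy => hp y ⟨hy.1, hy.2.trans hmt⟩) h2m
    -- As P decreases, the level at the crossing time m is a lower bound before m and an upper bound
    -- after m. The same w serves both legs, so their travel times telescope.
    have hw0 : 0 < switchFun g (z₁ m) (z₂ m) / 2 := by positivity
    refine ⟨_, hw0, ?_⟩
    have h1 := h.clock_le_travel hg hτ hκ hi hw0.le le_rfl hm.1 (hmt.trans ht) (fun r hr =>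
      ⟨(hl r hr).1.trans hm0.le, h2m.trans (hl r hr).2, Or.inl hw0⟩) (fun r hr => by
        have := (h.switch_pos_of_le hg hc hr.1 hr.2 (hmt.trans ht) hPm).2
        linarith)
    have h2 := hright m ⟨hm.1, hmt⟩ hm0.ge
    rw [hm0] at h1 h2
    rw [abs_of_neg hz0]
    rw [neg_zero] at h1
    rw [hm0]
    linarith

/-- As long as the origin is not reached, the elapsed rescaled time is bounded by the reaching time
plus the sliding time from the largest excursion. -/
theorem clock_le (hce : ∀ x, c (-x) = c x) {t Z : ℝ} (hat : a ≤ t) (ht : t < b)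
    (hz : ¬(z₁ t = 0 ∧ z₂ t = 0)) (hZ : ∀ r ∈ Icc a t, |z₁ r| ≤ Z) :
    τ t - τ a ≤ T + travelTime g 0 Z := by
  have hT0 : 0 ≤ T := (reachTime_nonneg hc le_rfl).trans (reachTime_le hc hic hT le_rfl)
  have hmonoZ : ∀ r ∈ Icc a t, travelTime g 0 |z₁ r| ≤ travelTime g 0 Z := fun r hr =>
    hg.travelTime_mono hi le_rfl (abs_nonneg _) (hZ r hr)
  wlog hpa : 0 ≤ switchFun g (z₁ a) (z₂ a) generalizing z₁ z₂
  · exact this (h.neg hg hce) (by simpa using hz) (by simpa using hZ) (by simpa using hmonoZ)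
      (by simp only [hg.switchFun_neg]; linarith)
  rcases hpa.eq_or_lt with hpa | hpa
  · have h1 := h.clock_le_sliding hg hτ hκ hi hc hce le_rfl hat ht hpa.symm hz
    have h2 := hmonoZ a (left_mem_Icc.2 hat)
    linarith
  rcases lt_or_ge 0 (switchFun g (z₁ t) (z₂ t)) with hpt | hpt
  · have hP : ∀ r ∈ Icc a t, 0 < switchFun g (z₁ r) (z₂ r) ∧
        switchFun g (z₁ t) (z₂ t) ≤ switchFun g (z₁ r) (z₂ r) := fun r hr =>
      h.switch_pos_of_le hg hc hr.1 hr.2 ht hpt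
    rcases le_or_gt (z₁ t) 0 with hzt | hzt
    · have h2t := snd_nonneg_of_switch_nonneg hg hzt hpt.le
      have hl := h.left_half hg hc le_rfl ht (fun y hy => (hP y ⟨hy.1, hy.2.le⟩).1) h2t
      have hw0 : 0 < switchFun g (z₁ t) (z₂ t) / 2 := by positivity
      have h1 := h.clock_le_travel hg hτ hκ hi hw0.le le_rfl hat ht (fun r hr =>
        ⟨(hl r hr).1.trans hzt, h2t.trans (hl r hr).2, Or.inl hw0⟩) (fun r hr => by
          have := (hP r hr).2
          linarith)
      have hza : z₁ a ≤ 0 := (hl a (left_mem_Icc.2 hat)).1.trans hzt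
      have h3 := OddProfile.travelTime_nonneg (g := g) (switchFun g (z₁ t) (z₂ t) / 2) (neg_nonneg.2 hzt)
      have h4 := hg.travelTime_le hi hw0.le (neg_nonneg.2 hza)
      have h5 := hmonoZ a (left_mem_Icc.2 hat)
      rw [abs_of_nonpos hza] at h5
      linarith
    · rcases hat.eq_or_lt with rfl | hat'
      · have := OddProfile.travelTime_nonneg (g := g) 0 ((abs_nonneg _).trans (hZ a (left_mem_Icc.2 le_rfl)))
        linarith
      obtain ⟨w, hw0, hw⟩ := h.exists_clock_le hg hτ hκ hi hc hcp hcc hic hT hat' ht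
        (fun y hy => (hP y ⟨hy.1, hy.2.le⟩).1) hzt
      have h3 := OddProfile.travelTime_nonneg (g := g) w hzt.le
      have h4 := hg.travelTime_le hi hw0.le (abs_nonneg (z₁ a))
      have h5 := hmonoZ a (left_mem_Icc.2 hat)
      linarith
  · obtain ⟨m, hm, hm0, hlt⟩ := h.exists_first_zero hg hat ht hpa hpt
    have hmb := hm.2.trans_lt ht
    have hslide := h.clock_le_sliding hg hτ hκ hi hc hce hm.1.le hm.2 ht hm0 hz
    have hZm := hmonoZ m ⟨hm.1.le, hm.2⟩
    have hZa := hmonoZ a (left_mem_Icc.2 hat)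
    rcases lt_trichotomy (z₁ m) 0 with hzm | hzm | hzm
    · have h2m := snd_nonneg_of_switch_nonneg hg hzm.le hm0.ge
      have hl := h.left_half hg hc le_rfl hmb hlt h2m
      have h1 := h.clock_le_travel hg hτ hκ hi le_rfl le_rfl hm.1.le hmb (fun r hr =>
        ⟨(hl r hr).1.trans hzm.le, h2m.trans (hl r hr).2, Or.inr ((hl r hr).1.trans_lt hzm)⟩)
        (fun r hr => by
          rcases hr.2.eq_or_lt with rfl | hrm
          · rw [hm0]; simp
          · have := hlt r ⟨hr.1, hrm⟩; linarith)
      have hza : z₁ a ≤ 0 := (hl a (left_mem_Icc.2 hm.1.le)).1.trans hzm.le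
      rw [abs_of_neg hzm] at hslide
      rw [abs_of_nonpos hza] at hZa
      linarith
    · exfalso
      have h2 := (two_mul_sq_eq_of_switch_eq_zero hm0).1
      rw [hzm, hg.zero, abs_zero] at h2
      exact hz (h.eq_zero_of_eq_zero hg hc hce hm.1.le hm.2 ht hzm (by nlinarith))
    · obtain ⟨w, hw0, hw⟩ := h.exists_clock_le hg hτ hκ hi hc hcp hcc hic hT hm.1 hmb hlt hzm
      rw [abs_of_pos hzm] at hslide hZm
      -- Reaching plus sliding costs at most T + `travelTime g w |z₁ a|` + (`travelTime g 0 (z₁ m)`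
      -- - `travelTime g w (z₁ m)`). If z₁ m is the smaller excursion, the bracket grows when
      -- evaluated at |z₁ a|; otherwise the first travel time is at most the one subtracted.
      rcases le_total (z₁ m) |z₁ a| with hle | hle
      · have := hg.travelTime_gain_mono hi hw0.le hzm.le hle
        linarith
      · have := hg.travelTime_mono hi hw0.le (abs_nonneg _) hle
        linarith

/-- The origin is reached before the clock exceeds the sum of the two design times. -/
theorem exists_eq_zero (hce : ∀ x, c (-x) = c x) {T₁ : ℝ}
    (hT₁ : ∫ x in Ioi (0:ℝ), slowness g 0 x = T₁)
    (hlim : ∀ C < T₁ + T, ∃ t ∈ Ico a b, C < τ t - τ a)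
    (hcoer : ∀ y, ∃ Z, 0 ≤ Z ∧ y < g Z) :
    ∃ t ∈ Ico a b, ∀ s ∈ Ico t b, z₁ s = 0 ∧ z₂ s = 0 := by
  by_contra hcon
  have hne : ∀ t ∈ Ico a b, ¬(z₁ t = 0 ∧ z₂ t = 0) := fun t ht h0 =>
    hcon ⟨t, ht, fun s hs => h.eq_zero_of_eq_zero hg hc hce ht.1 hs.1 hs.2 h0.1 h0.2⟩
  -- Z bounds |z₁| along the entire flow by `bound`, so `clock_le` caps the clock strictly below T₁
  -- + T, against `hlim`.
  obtain ⟨Z, hZ0, hZ⟩ := hcoer (|g (z₁ a)| + 2 * z₂ a ^ 2)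
  obtain ⟨t, ht, hlt⟩ := hlim (T + travelTime g 0 Z) (by
    have := hg.travelTime_lt hi hZ0 hT₁; linarith)
  have := h.clock_le hg hτ hκ hi hc hcp hcc hic hT hce ht.1 ht.2 (hne t ht) (Z := Z) fun r hr => by
    have h1 := (h.bound hg hc hce hr.1 (hr.2.trans_lt ht.2)).1
    rw [hg.abs_apply] at h1
    exact (hg.strictMono.lt_iff_lt.1 (h1.trans_lt hZ)).le
  linarith

end

end ReachingFlow

/-! ### Filippov sets at points of continuity -/

/-- Near a continuity point the coordinate stays in a small interval, a closed convex condition that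
survives convex hull and closure. Stated per coordinate because the first one is continuous
everywhere, the second only off the surface. -/
theorem filippovMap_apply_eq {f : ℝ → State → State} {t : ℝ} {x v : State}
    (hv : v ∈ filippovMap f t x) (i : Fin 2) (hc : ContinuousAt (fun y => f t y i) x) :
    v i = f t x i := by
  refine eq_of_forall_dist_le fun ε hε => ?_
  obtain ⟨r, hr, hball⟩ := Metric.continuousAt_iff.1 hc ε hε
  simp only [filippovMap, mem_iInter] at hv
  have h1 := hv r hr ∅ measure_empty
  have hclosed : IsClosed {y : State | dist (y i) (f t x i) ≤ ε} :=
    isClosed_le (by fun_prop) continuous_const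
  have hconv : Convex ℝ {y : State | dist (y i) (f t x i) ≤ ε} :=
    (convex_closedBall (f t x i) ε).linear_preimage
      (LinearMap.proj i : State →ₗ[ℝ] ℝ)
  refine closure_minimal (convexHull_min ?_ hconv) hclosed h1
  rintro _ ⟨y, hy, rfl⟩
  exact (hball (Metric.mem_ball.1 hy.1)).le

/-! ### The controller in explicit form -/

theorem spow_one (x : ℝ) : spow x 1 = x := by
  rw [spow, Real.rpow_one]
  rcases lt_trichotomy x 0 with h | rfl | h
  · rw [Real.sign_of_neg h, abs_of_neg h]; ring
  · simp
  · rw [Real.sign_of_pos h, abs_of_pos h]; ring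

theorem spow_two (x : ℝ) : spow x 2 = x * |x| := by
  rw [spow, Real.rpow_two, sq_abs]
  rcases lt_trichotomy x 0 with h | rfl | h
  · rw [Real.sign_of_neg h, abs_of_neg h]; ring
  · simp
  · rw [Real.sign_of_pos h, abs_of_pos h]; ring

theorem spow_three (x : ℝ) : spow x 3 = x ^ 3 := by
  rw [spow, show (3:ℝ) = ((3:ℕ):ℝ) by norm_num, Real.rpow_natCast]
  rcases lt_trichotomy x 0 with h | rfl | h
  · rw [Real.sign_of_neg h, abs_of_neg h]; ring
  · simp
  · rw [Real.sign_of_pos h, abs_of_pos h]; ring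

theorem spow_half (x : ℝ) : spow x (1 / 2) = Real.sqrt x - Real.sqrt (-x) := by
  rw [spow, ← Real.sqrt_eq_rpow]
  rcases lt_trichotomy x 0 with h | rfl | h
  · rw [Real.sign_of_neg h, abs_of_neg h, Real.sqrt_eq_zero_of_nonpos h.le]; ring
  · simp
  · rw [Real.sign_of_pos h, abs_of_pos h, Real.sqrt_eq_zero_of_nonpos (neg_nonpos.2 h.le)]; ring

theorem gammaOne_eq_gammaTwo (a b : ℝ) : gammaOne a b = gammaTwo a b 1 3 (1 / 2) := by
  have h1 : mP 1 3 (1 / 2) = 1 / 4 := by unfold mP; norm_num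
  have h2 : mQ 1 3 (1 / 2) = 1 / 4 := by unfold mQ; norm_num
  rw [gammaOne, gammaTwo, h1, h2]
  congr 2
  · ring
  · ring

/-- The cubic profile of the sliding surface. -/
def cubicProfile (a b T z : ℝ) : ℝ := 2 * gammaOne a b ^ 2 / T ^ 2 * (a * z + b * z ^ 3)

/-- The derivative of the cubic profile. -/
def cubicProfileDeriv (a b T z : ℝ) : ℝ := 2 * gammaOne a b ^ 2 / T ^ 2 * (a + 3 * b * z ^ 2)

/-- The reaching law of the sliding variable. -/
def reachRate (a b p q k T s : ℝ) : ℝ := gammaTwo a b p q k / T * (a * |s| ^ p + b * |s| ^ q) ^ k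

theorem gammaOne_pos {a b : ℝ} (ha : 0 < a) (hb : 0 < b) : 0 < gammaOne a b := by
  rw [gammaOne_eq_gammaTwo]
  exact gammaTwo_pos ha hb (by norm_num) (by norm_num) (by norm_num) (by norm_num)

theorem oddProfile_cubic {a b T : ℝ} (ha : 0 < a) (hb : 0 < b) (hT : 0 < T) :
    OddProfile (cubicProfile a b T) (cubicProfileDeriv a b T) where
  hasDerivAt x := by
    have h := (((hasDerivAt_id x).const_mul a).add ((hasDerivAt_pow 3 x).const_mul b)).const_mul
      (2 * gammaOne a b ^ 2 / T ^ 2)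
    refine h.congr_deriv ?_
    simp only [cubicProfileDeriv]
    norm_num
    left; ring
  continuous_deriv := by unfold cubicProfileDeriv; fun_prop
  deriv_pos x := by
    have := gammaOne_pos ha hb
    unfold cubicProfileDeriv
    positivity
  odd x := by unfold cubicProfile; ring

theorem exists_lt_cubicProfile {a b T : ℝ} (ha : 0 < a) (hb : 0 < b) (hT : 0 < T) (y : ℝ) :
    ∃ Z, 0 ≤ Z ∧ y < cubicProfile a b T Z := by
  have hγ := gammaOne_pos ha hb
  set K := 2 * gammaOne a b ^ 2 / T ^ 2 with hK
  have hK0 : 0 < K := by positivity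
  have hZ : 0 < |y| / (K * a) + 1 := by positivity
  refine ⟨|y| / (K * a) + 1, hZ.le, ?_⟩
  set Z := |y| / (K * a) + 1 with hZe
  have h1 : K * a * Z = |y| + K * a := by rw [hZe]; field_simp
  have h2 : 0 < K * (b * Z ^ 3) := by positivity
  have h3 : 0 < K * a := by positivity
  unfold cubicProfile
  rw [← hK]
  nlinarith [le_abs_self y]

theorem slowness_cubic {a b T x : ℝ} (ha : 0 < a) (hb : 0 < b) (hT : 0 < T) (hx : 0 < x) :
    slowness (cubicProfile a b T) 0 x =
      T / gammaOne a b * (a * x ^ (1:ℝ) + b * x ^ (3:ℝ)) ^ (-(1 / 2) : ℝ) := by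
  have hγ := gammaOne_pos ha hb
  rw [slowness, abs_of_pos ((oddProfile_cubic ha hb hT).pos hx), Real.rpow_one,
    show (3:ℝ) = ((3:ℕ):ℝ) by norm_num, Real.rpow_natCast,
    Real.rpow_neg (by positivity), ← Real.sqrt_eq_rpow]
  have h1 : cubicProfile a b T x / 2 + 0 = (gammaOne a b / T) ^ 2 * (a * x + b * x ^ 3) := by
    unfold cubicProfile; field_simp; ring
  rw [h1, Real.sqrt_mul (by positivity), Real.sqrt_sq (by positivity), mul_inv,
    inv_div]

/-- The factor 2 in the profile cancels the 1/2 in `slowness`, leaving T/γ₁ times the Beta integral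
with p = 1, q = 3, k = 1/2, whose value is γ₁. -/
theorem integrableOn_slowness_cubic {a b T : ℝ} (ha : 0 < a) (hb : 0 < b) (hT : 0 < T) :
    IntegrableOn (slowness (cubicProfile a b T) 0) (Ioi 0) ∧
      ∫ x in Ioi (0:ℝ), slowness (cubicProfile a b T) 0 x = T := by
  have hγ := gammaOne_pos ha hb
  obtain ⟨h1, h2⟩ := integrableOn_rpow_add_rpow (p := 1) (q := 3) (k := 1 / 2) ha hb (by norm_num)
    (by norm_num) (by norm_num) (by norm_num)
  constructor
  · exact (integrableOn_congr_fun (fun x hx => slowness_cubic ha hb hT hx) measurableSet_Ioi).2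
      (h1.const_mul _)
  · rw [setIntegral_congr_fun measurableSet_Ioi fun x hx => slowness_cubic ha hb hT hx,
      integral_const_mul, h2, ← gammaOne_eq_gammaTwo]
    field_simp

section reachRate
variable {a b p q k T : ℝ} (ha : 0 < a) (hb : 0 < b) (hpq : p < q) (hkp : k * p < 1)
  (hkq : 1 < k * q) (hk : 0 < k) (hT : 0 < T)
include ha hb hpq hkp hkq hk hT

theorem reachRate_nonneg (s : ℝ) : 0 ≤ reachRate a b p q k T s := by
  have hγ := gammaTwo_pos ha hb hpq hkp hkq hk
  unfold reachRate
  positivity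

theorem reachRate_pos {s : ℝ} (hs : 0 < s) : 0 < reachRate a b p q k T s := by
  have hγ := gammaTwo_pos ha hb hpq hkp hkq hk
  have := abs_pos.2 hs.ne'
  unfold reachRate
  positivity

omit ha hb hpq hkp hkq hT in
theorem continuous_reachRate (hp : 0 < p) (hq : 0 < q) : Continuous (reachRate a b p q k T) := by
  unfold reachRate
  refine continuous_const.mul (Continuous.rpow_const ?_ fun _ => Or.inr hk.le)
  exact (continuous_const.mul (continuous_abs.rpow_const fun _ => Or.inr hp.le)).add
    (continuous_const.mul (continuous_abs.rpow_const fun _ => Or.inr hq.le))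

theorem integrableOn_inv_reachRate :
    IntegrableOn (fun s => (reachRate a b p q k T s)⁻¹) (Ioi 0) ∧
      ∫ s in Ioi (0:ℝ), (reachRate a b p q k T s)⁻¹ = T := by
  have hγ := gammaTwo_pos ha hb hpq hkp hkq hk
  obtain ⟨h1, h2⟩ := integrableOn_rpow_add_rpow ha hb hpq hkp hkq hk
  have he : EqOn (fun s => (reachRate a b p q k T s)⁻¹) (fun s => T / gammaTwo a b p q k *
      (a * s ^ p + b * s ^ q) ^ (-k)) (Ioi 0) := fun s hs => by
    have hs' : (0:ℝ) < s := hs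
    simp only [reachRate]
    rw [abs_of_pos hs', mul_inv, inv_div, Real.rpow_neg (by positivity)]
  constructor
  · exact (integrableOn_congr_fun he measurableSet_Ioi).2 (h1.const_mul _)
  · rw [setIntegral_congr_fun measurableSet_Ioi he, integral_const_mul, h2]
    field_simp

end reachRate

theorem sigmaVar_eq_slideVar (a b T : ℝ) (z : State) :
    sigmaVar a b T z = slideVar (cubicProfile a b T) (z 0) (z 1) := by
  rw [sigmaVar, slideVar, spow_half, spow_two, spow_one, spow_three, cubicProfile]
  ring

theorem slidingControl_eq (α₁ α₂ β₁ β₂ p q k T₁ T₂ : ℝ) (ζ : ℝ → ℝ) (z : State) (τ : ℝ) :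
    slidingControl α₁ α₂ β₁ β₂ p q k T₁ T₂ ζ z τ =
      -(reachRate α₂ β₂ p q k T₂ (slideVar (cubicProfile α₁ β₁ T₁) (z 0) (z 1)) +
        cubicProfileDeriv α₁ β₁ T₁ (z 0) / 4 + ζ τ) *
      Real.sign (slideVar (cubicProfile α₁ β₁ T₁) (z 0) (z 1)) := by
  rw [slidingControl, sigmaVar_eq_slideVar, reachRate, cubicProfileDeriv]
  congr 3
  by_cases hT : T₁ = 0
  · simp [hT]
  · field_simp; ring

theorem charpoly_auxA (α : ℝ) :
    (auxA α).charpoly = Polynomial.X ^ 2 + Polynomial.C α * Polynomial.X := by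
  rw [Matrix.charpoly_fin_two]
  simp [auxA, Matrix.trace_fin_two, Matrix.det_fin_two]

theorem coeffOne_eq (α : ℝ) : coeffOne α = α := by
  rw [coeffOne, charpoly_auxA]
  simp [Polynomial.coeff_X_pow]

theorem coeffTwo_eq (α : ℝ) : coeffTwo α = 0 := by
  rw [coeffTwo, charpoly_auxA]
  simp [Polynomial.coeff_X_pow]

theorem transQ_eq (α : ℝ) : transQ α = 1 := by
  rw [transQ, coeffOne_eq]
  ext i j
  fin_cases i <;> fin_cases j <;>
    simp [controllability, auxA, auxB, Matrix.mul_apply, Fin.sum_univ_two]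

theorem upsilon_eq (α : ℝ) (w : State → ℝ → ℝ) (y : State) (τ : ℝ) :
    upsilon α w y τ = w y τ + α * y 1 := by
  simp [upsilon, transQ_eq, coeffOne_eq, coeffTwo_eq]

theorem omegaMat_inv_mulVec {κ : ℝ} (hκ : κ ≠ 0) (x : State) :
    (omegaMat κ)⁻¹.mulVec x = ![x 0, x 1 / κ] := by
  have h : (omegaMat κ)⁻¹ = Matrix.diagonal fun i : Fin 2 => (κ ^ (i : ℕ))⁻¹ := by
    refine Matrix.inv_eq_left_inv ?_
    rw [omegaMat, Matrix.diagonal_mul_diagonal, ← Matrix.diagonal_one]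
    congr 1
    funext i
    exact inv_mul_cancel₀ (pow_ne_zero _ hκ)
  rw [h]
  funext i
  rw [Matrix.mulVec_diagonal]
  fin_cases i
  · simp
  · simp [div_eq_inv_mul]

/-! ### The rescaled clock -/

/-- The gain `κ` on the finite horizon, as a function of the current time. -/
def clockRate (α η Tc t₀ t : ℝ) : ℝ := η / (α * (Tc - η * (t - t₀)))

/-- The rescaled time, as a function of the current time. -/
def clock (α η Tc t₀ t : ℝ) : ℝ := tauOf α η Tc (t - t₀)

section clock
variable {α η Tc t₀ : ℝ} (hα : 0 < α) (hTc : 0 < Tc) (hη0 : 0 < η) (hη1 : η < 1)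
include hα hTc hη0 hη1

omit hα in
theorem clock_denom_pos {t : ℝ} (ht : t ∈ Icc t₀ (t₀ + Tc)) : 0 < Tc - η * (t - t₀) := by
  have h1 : 0 ≤ t - t₀ := by linarith [ht.1]
  have h2 : t - t₀ ≤ Tc := by linarith [ht.2]
  nlinarith

theorem clockRate_pos {t : ℝ} (ht : t ∈ Icc t₀ (t₀ + Tc)) : 0 < clockRate α η Tc t₀ t := by
  have := clock_denom_pos hTc hη0 hη1 ht
  unfold clockRate
  positivity

theorem clockRate_le {t : ℝ} (ht : t ∈ Icc t₀ (t₀ + Tc)) :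
    clockRate α η Tc t₀ t ≤ η / (α * (Tc * (1 - η))) := by
  have h1 : 0 < 1 - η := by linarith
  unfold clockRate
  have h2 : t - t₀ ≤ Tc := by linarith [ht.2]
  have : Tc * (1 - η) ≤ Tc - η * (t - t₀) := by nlinarith
  gcongr

theorem continuousOn_clockRate : ContinuousOn (clockRate α η Tc t₀) (Ico t₀ (t₀ + Tc)) := by
  unfold clockRate
  refine ContinuousOn.div (by fun_prop) (by fun_prop) fun t ht => ?_
  have := clock_denom_pos hTc hη0 hη1 (Ico_subset_Icc_self ht)
  positivity

theorem hasDerivAt_clock {t : ℝ} (ht : t ∈ Icc t₀ (t₀ + Tc)) :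
    HasDerivAt (clock α η Tc t₀) (clockRate α η Tc t₀ t) t := by
  have h0 := clock_denom_pos hTc hη0 hη1 ht
  have h1 : HasDerivAt (fun t => 1 - η * (t - t₀) / Tc) (-(η / Tc)) t := by
    have := ((((hasDerivAt_id t).sub_const t₀).const_mul η).div_const Tc).const_sub 1
    simpa using this
  have hne : 1 - η * (t - t₀) / Tc ≠ 0 := by
    rw [show 1 - η * (t - t₀) / Tc = (Tc - η * (t - t₀)) / Tc by field_simp]
    positivity
  have h2 := (h1.log hne).const_mul (-α⁻¹)
  refine h2.congr_deriv ?_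
  unfold clockRate
  rw [show 1 - η * (t - t₀) / Tc = (Tc - η * (t - t₀)) / Tc by field_simp]
  field_simp

omit hα hTc hη0 hη1 in
theorem clock_start : clock α η Tc t₀ t₀ = 0 := by simp [clock, tauOf]

theorem clock_nonneg {t : ℝ} (ht : t ∈ Icc t₀ (t₀ + Tc)) : 0 ≤ clock α η Tc t₀ t := by
  have h0 := clock_denom_pos hTc hη0 hη1 ht
  unfold clock tauOf
  have h1 : 0 ≤ t - t₀ := by linarith [ht.1]
  have h2 : 0 < 1 - η * (t - t₀) / Tc := by
    rw [show 1 - η * (t - t₀) / Tc = (Tc - η * (t - t₀)) / Tc by field_simp]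
    positivity
  have h3 : Real.log (1 - η * (t - t₀) / Tc) ≤ 0 := by
    apply Real.log_nonpos h2.le
    have : 0 ≤ η * (t - t₀) / Tc := by positivity
    linarith
  have := inv_pos.2 hα
  nlinarith

/-- Identifies the factor in the hypothesis on ζ as 1/κ, so that ζ dominates the rescaled
disturbance δ/κ². -/
theorem scale_exp_clock {t : ℝ} (ht : t ∈ Icc t₀ (t₀ + Tc)) :
    α * η⁻¹ * Tc * Real.exp (-α * clock α η Tc t₀ t) = (clockRate α η Tc t₀ t)⁻¹ := by
  have h0 := clock_denom_pos hTc hη0 hη1 ht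
  have h2 : 0 < 1 - η * (t - t₀) / Tc := by
    rw [show 1 - η * (t - t₀) / Tc = (Tc - η * (t - t₀)) / Tc by field_simp]
    positivity
  unfold clock tauOf clockRate
  rw [show -α * (-α⁻¹ * Real.log (1 - η * (t - t₀) / Tc)) =
    Real.log (1 - η * (t - t₀) / Tc) by field_simp, Real.exp_log h2]
  field_simp

/-- By the choice of η the clock equals T at the end of the horizon, and η < 1 makes it continuous
there, so values just below T occur earlier. -/
theorem exists_lt_clock {T C : ℝ} (hηT : η = 1 - Real.exp (-α * T)) (hC : C < T) :
    ∃ t ∈ Ico t₀ (t₀ + Tc), C < clock α η Tc t₀ t := by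
  have hmem : t₀ + Tc ∈ Icc t₀ (t₀ + Tc) := ⟨by linarith, le_rfl⟩
  have hend : clock α η Tc t₀ (t₀ + Tc) = T := by
    unfold clock tauOf
    rw [show 1 - η * (t₀ + Tc - t₀) / Tc = 1 - η by field_simp; ring, hηT,
      show 1 - (1 - Real.exp (-α * T)) = Real.exp (-α * T) by ring, Real.log_exp]
    field_simp
  have hcont := (hasDerivAt_clock hα hTc hη0 hη1 hmem).continuousAt
  have h1 : ∀ᶠ t in 𝓝[<] (t₀ + Tc), C < clock α η Tc t₀ t :=
    (hcont.mono_left nhdsWithin_le_nhds).eventually (lt_mem_nhds (by rwa [hend]))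
  have h2 : ∀ᶠ t in 𝓝[<] (t₀ + Tc), t ∈ Ico t₀ (t₀ + Tc) := Ico_mem_nhdsLT (by linarith)
  obtain ⟨t, ht⟩ := (h1.and h2).exists
  exact ⟨t, ht.2, ht.1⟩

theorem redesigned_eq (w : State → ℝ → ℝ) (wL : State → ℝ) {t : ℝ} (ht : t ∈ Ico t₀ (t₀ + Tc))
    (x : State) :
    redesigned α η Tc w wL t₀ t x = clockRate α η Tc t₀ t ^ 2 *
      (w ![x 0, x 1 / clockRate α η Tc t₀ t] (clock α η Tc t₀ t) +
        α * (x 1 / clockRate α η Tc t₀ t)) := by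
  have hκ : kappa α η Tc (t - t₀) = clockRate α η Tc t₀ t := by
    rw [kappa, if_pos ⟨by linarith [ht.1], by linarith [ht.2]⟩, clockRate]
  have hpos := clockRate_pos hα hTc hη0 hη1 (Ico_subset_Icc_self ht)
  rw [redesigned, if_pos ⟨ht.1, ht.2⟩, hκ, upsilon_eq, omegaMat_inv_mulVec hpos.ne']
  simp [clock]

end clock

/-! ### Closed-loop trajectories as reaching flows -/

theorem continuous_slideVar {g : ℝ → ℝ} (hg : Continuous g) :
    Continuous fun y : ℝ × ℝ => slideVar g y.1 y.2 := by
  unfold slideVar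
  fun_prop

theorem continuousAt_sign {x : ℝ} (hx : x ≠ 0) : ContinuousAt Real.sign x := by
  rcases hx.lt_or_gt with h | h
  · refine (continuousAt_const (y := (-1 : ℝ))).congr ?_
    filter_upwards [Iio_mem_nhds h] with y hy
    exact (Real.sign_of_neg hy).symm
  · refine (continuousAt_const (y := (1 : ℝ))).congr ?_
    filter_upwards [Ioi_mem_nhds h] with y hy
    exact (Real.sign_of_pos hy).symm

theorem IsFilippovSolution.continuousOn {f : ℝ → State → State} {t₀ : ℝ} {x : ℝ → State}
    (hx : IsFilippovSolution f t₀ x) : ContinuousOn x (Ici t₀) := by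
  intro t ht
  have ht' : t₀ ≤ t + 1 := le_trans ht (by linarith)
  have h1 := (hx.absCont (t + 1) ht').continuousOn
  rw [uIcc_of_le ht'] at h1
  refine (h1 t ⟨ht, by linarith⟩).mono_of_mem_nhdsWithin ?_
  rw [← Ici_inter_Iic]
  exact inter_mem_nhdsWithin _ (Iic_mem_nhds (by linarith))

theorem IsFilippovSolution.ac_apply {f : ℝ → State → State} {t₀ : ℝ} {x : ℝ → State}
    (hx : IsFilippovSolution f t₀ x) {t : ℝ} (ht : t₀ ≤ t) (i : Fin 2) :
    AbsolutelyContinuousOnInterval (fun s => x s i) t₀ t :=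
  AbsolutelyContinuousOnInterval.comp_lipschitzOn (φ := fun y : State => y i) (S := univ)
    (LipschitzWith.eval i).lipschitzOnWith (hx.absCont t ht) fun _ _ => mem_univ _

section closedLoop
variable {L α Tc α₁ α₂ β₁ β₂ p q k Tc₁ Tc₂ η : ℝ} {ζ : ℝ → ℝ} {wL : State → ℝ}
  (hα : 0 < α) (hTc : 0 < Tc)
  (hα₁ : 0 < α₁) (hβ₁ : 0 < β₁)
  (hp : 0 < p) (hq : 0 < q) (hk : 0 < k)
  (hTc₁ : 0 < Tc₁) (hη0 : 0 < η) (hη1 : η < 1)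
include hα hTc hα₁ hβ₁ hp hq hk hTc₁ hη0 hη1

/-- The sign factor is the only discontinuous ingredient of the law in the state; the root inside σ
is continuous even where it is not differentiable. -/
theorem continuousAt_redesigned {t₀ t : ℝ} (ht : t ∈ Ico t₀ (t₀ + Tc)) {x : State}
    (hσ : slideVar (cubicProfile α₁ β₁ Tc₁) (x 0) (x 1 / clockRate α η Tc t₀ t) ≠ 0) :
    ContinuousAt (redesigned α η Tc (slidingControl α₁ α₂ β₁ β₂ p q k Tc₁ Tc₂ ζ) wL t₀ t) x := by
  have hg := oddProfile_cubic hα₁ hβ₁ hTc₁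
  have he : redesigned α η Tc (slidingControl α₁ α₂ β₁ β₂ p q k Tc₁ Tc₂ ζ) wL t₀ t = _ :=
    funext fun y => redesigned_eq hα hTc hη0 hη1 _ wL ht y
  rw [he]
  simp only [slidingControl_eq, Matrix.cons_val_zero, Matrix.cons_val_one]
  have hs : Continuous fun y : State =>
      slideVar (cubicProfile α₁ β₁ Tc₁) (y 0) (y 1 / clockRate α η Tc t₀ t) :=
    (continuous_slideVar hg.continuous).comp
      (f := fun y : State => (y 0, y 1 / clockRate α η Tc t₀ t)) (by fun_prop)
  have hsign : ContinuousAt (fun y : State => Real.sign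
      (slideVar (cubicProfile α₁ β₁ Tc₁) (y 0) (y 1 / clockRate α η Tc t₀ t))) x :=
    ContinuousAt.comp (g := Real.sign) (continuousAt_sign hσ) hs.continuousAt
  have hr := (continuous_reachRate (a := α₂) (b := β₂) (T := Tc₂) hk hp hq).comp hs
  have hd := hg.continuous_deriv.comp (continuous_apply (A := fun _ : Fin 2 => ℝ) 0)
  have h1 : ContinuousAt (fun y : State => -(reachRate α₂ β₂ p q k Tc₂
      (slideVar (cubicProfile α₁ β₁ Tc₁) (y 0) (y 1 / clockRate α η Tc t₀ t)) +
      cubicProfileDeriv α₁ β₁ Tc₁ (y 0) / 4 + ζ (clock α η Tc t₀ t))) x :=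
    ((hr.add (hd.div_const 4)).add continuous_const).neg.continuousAt
  refine continuousAt_const.mul ((h1.mul hsign).add ?_)
  exact Continuous.continuousAt (by fun_prop)

/-- In the rescaled coordinates a trajectory is a reaching flow. -/
theorem IsFilippovSolution.reachingFlow
    (hζ : ∀ τ : ℝ, 0 ≤ τ → (α * η⁻¹ * Tc * Real.exp (-α * τ)) ^ 2 * L ≤ ζ τ)
    {t₀ : ℝ} {δ : ℝ → ℝ} (hδ : δ ∈ admissible L t₀) {x : ℝ → State}
    (hx : IsFilippovSolution (closedLoopField
      (redesigned α η Tc (slidingControl α₁ α₂ β₁ β₂ p q k Tc₁ Tc₂ ζ) wL t₀) δ) t₀ x) :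
    ReachingFlow (cubicProfile α₁ β₁ Tc₁) (cubicProfileDeriv α₁ β₁ Tc₁)
      (reachRate α₂ β₂ p q k Tc₂) (clockRate α η Tc t₀) (fun t => x t 0)
      (fun t => x t 1 / clockRate α η Tc t₀ t) t₀ (t₀ + Tc) := by
  have hg := oddProfile_cubic hα₁ hβ₁ hTc₁
  have hinv : ∀ t, HasDerivAt (fun t => (clockRate α η Tc t₀ t)⁻¹) (-α) t := fun t => by
    have h := (((((hasDerivAt_id t).sub_const t₀).const_mul η).const_sub Tc).const_mul α).div_const η
    have he : (fun t => (clockRate α η Tc t₀ t)⁻¹) =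
        fun t => α * (Tc - η * (id t - t₀)) / η := by
      funext t; rw [clockRate, inv_div]; rfl
    rw [he]
    exact h.congr_deriv (by field_simp)
  refine ⟨fun t ht => hx.ac_apply ht.1 0, fun t ht => ?_, fun t ht =>
    clockRate_pos hα hTc hη0 hη1 (Ico_subset_Icc_self ht), ?_⟩
  · exact (hx.ac_apply ht.1 1).mul
      (absolutelyContinuousOnInterval_of_hasDerivAt (fun s _ => hinv s) continuousOn_const)
  have hd := hx.deriv_mem
  rw [ae_restrict_iff' measurableSet_Ici] at hd
  filter_upwards [hd] with t ht hmem
  obtain ⟨v, hv, hder⟩ := ht hmem.1.le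
  have htI : t ∈ Ico t₀ (t₀ + Tc) := ⟨hmem.1.le, hmem.2⟩
  have htc := Ico_subset_Icc_self htI
  have hpos := clockRate_pos hα hTc hη0 hη1 htc
  have hder' := hasDerivAt_pi.1 hder
  have hv0 : v 0 = x t 1 := filippovMap_apply_eq hv 0 (by
    simp only [closedLoopField, Matrix.cons_val_zero]
    exact (continuous_apply (A := fun _ : Fin 2 => ℝ) 1).continuousAt)
  have hv1 : slideVar (cubicProfile α₁ β₁ Tc₁) (x t 0) (x t 1 / clockRate α η Tc t₀ t) ≠ 0 →
      v 1 = clockRate α η Tc t₀ t ^ 2 * (slidingControl α₁ α₂ β₁ β₂ p q k Tc₁ Tc₂ ζ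
        ![x t 0, x t 1 / clockRate α η Tc t₀ t] (clock α η Tc t₀ t) +
        α * (x t 1 / clockRate α η Tc t₀ t)) + δ t := fun hne => by
    have h := filippovMap_apply_eq hv 1 (by
      simp only [closedLoopField, Matrix.cons_val_one]
      exact (continuousAt_redesigned hα hTc hα₁ hβ₁ hp hq hk hTc₁ hη0 hη1 htI hne).add
        continuousAt_const)
    rw [h, closedLoopField, ← redesigned_eq hα hTc hη0 hη1 _ wL htI]
    simp
  have hcomp : ∀ s : ℝ, v 1 = clockRate α η Tc t₀ t ^ 2 * (s +
      α * (x t 1 / clockRate α η Tc t₀ t)) + δ t →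
      v 1 / clockRate α η Tc t₀ t ^ 2 - α * (x t 1 / clockRate α η Tc t₀ t) =
        s + δ t * (clockRate α η Tc t₀ t)⁻¹ ^ 2 := fun s hs => by
    rw [hs]; field_simp; ring
  have hζt : (clockRate α η Tc t₀ t)⁻¹ ^ 2 * L ≤ ζ (clock α η Tc t₀ t) := by
    rw [← scale_exp_clock hα hTc hη0 hη1 htc]
    exact hζ _ (clock_nonneg hα hTc hη0 hη1 htc)
  have hδt := abs_le.1 (hδ.2 t hmem.1.le)
  have hr2 : 0 ≤ (clockRate α η Tc t₀ t)⁻¹ ^ 2 := sq_nonneg _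
  -- Differentiating x₂/κ with (1/κ)' = -α gives κ(v₁/κ² - αz₂), where v₁ is the derivative of x₂;
  -- the bracket is the rescaled input, equal to w + δ/κ² off the surface.
  refine ⟨v 1 / clockRate α η Tc t₀ t ^ 2 - α * (x t 1 / clockRate α η Tc t₀ t), ?_, ?_,
    fun hP => ?_, fun hP => ?_⟩
  · refine (hder' 0).congr_deriv ?_
    rw [hv0]; field_simp
  · refine ((hder' 1).mul (hinv t)).congr_deriv ?_
    field_simp; ring
  · have hσ := OddProfile.slideVar_pos hP
    rw [hcomp _ (hv1 hσ.ne'), slidingControl_eq]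
    simp only [Matrix.cons_val_zero, Matrix.cons_val_one]
    rw [Real.sign_of_pos hσ]
    nlinarith [mul_le_mul_of_nonneg_right hδt.2 hr2]
  · have hσ := hg.slideVar_neg_of hP
    rw [hcomp _ (hv1 hσ.ne), slidingControl_eq]
    simp only [Matrix.cons_val_zero, Matrix.cons_val_one]
    rw [Real.sign_of_neg hσ]
    nlinarith [mul_le_mul_of_nonneg_right hδt.1 hr2]

omit hα hα₁ hβ₁ hp hq hk hTc₁ hη0 hη1 in
/-- After the switch to `wL`, a trajectory at the origin stays there. -/
theorem IsFilippovSolution.eq_zero_after {w : State → ℝ → ℝ} (hwL : RobustlyStabilizes wL L)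
    {t₀ : ℝ} (ht₀ : 0 ≤ t₀) {δ : ℝ → ℝ} (hδ : δ ∈ admissible L t₀) {x : ℝ → State}
    (hx : IsFilippovSolution (closedLoopField (redesigned α η Tc w wL t₀) δ) t₀ x)
    (h0 : x (t₀ + Tc) = 0) {t : ℝ} (ht : t₀ + Tc ≤ t) : x t = 0 := by
  have hsol : IsTrajectory (fun _ _ y => wL y) δ (t₀ + Tc) 0 x := by
    refine ⟨⟨fun s hs => ?_, ?_⟩, h0⟩
    · refine (hx.absCont s (by linarith)).mono ?_
      rw [uIcc_of_le hs, uIcc_of_le (by linarith)]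
      exact Icc_subset_Icc_left (by linarith)
    · have hd := hx.deriv_mem
      rw [ae_restrict_iff' measurableSet_Ici] at hd ⊢
      filter_upwards [hd] with s hs hmem
      have hmem' : t₀ + Tc ≤ s := hmem
      obtain ⟨v, hv, hder⟩ := hs (show t₀ ≤ s by linarith)
      refine ⟨v, ?_, hder⟩
      have he : closedLoopField (redesigned α η Tc w wL t₀) δ s =
          closedLoopField (fun _ y => wL y) δ s := by
        funext y
        simp only [closedLoopField, redesigned]
        rw [if_neg fun hcon => absurd hcon.2 (not_lt.2 hmem')]
      simpa only [filippovMap, he] using hv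
  -- The restarted trajectory begins at 0, inside every ball of radius d, so its norm is below every
  -- ε. Convergence under wL is not needed.
  have hstab := (hwL δ (t₀ + Tc) (by linarith)).1
  rw [← norm_le_zero_iff]
  refine le_of_forall_pos_le_add fun ε hε => ?_
  obtain ⟨d, hd, hball⟩ := hstab ε hε
  rw [zero_add]
  exact (hball 0 (by simpa using hd) δ ⟨⟨hδ.1, fun s hs => hδ.2 s (by linarith)⟩, rfl⟩ x hsol t
    ht).le

end closedLoop

end

/-! ### Fixed-time stability of the closed loop -/

theorem mainTheorem7
    (L α Tc α₁ α₂ β₁ β₂ p q k Tc₁ Tc₂ η : ℝ) (ζ : ℝ → ℝ) (wL : State → ℝ)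
    (hα : 0 < α) (hTc : 0 < Tc)
    (hα₁ : 0 < α₁) (hα₂ : 0 < α₂) (hβ₁ : 0 < β₁) (hβ₂ : 0 < β₂)
    (hp : 0 < p) (hq : 0 < q) (hk : 0 < k) (hkp : k * p < 1) (hkq : 1 < k * q)
    (hTc₁ : 0 < Tc₁) (hTc₂ : 0 < Tc₂)
    (hη : η = 1 - Real.exp (-α * (Tc₁ + Tc₂)))
    (hζ : ∀ τ : ℝ, 0 ≤ τ → (α * η⁻¹ * Tc * Real.exp (-α * τ)) ^ 2 * L ≤ ζ τ)
    (hwL : RobustlyStabilizes wL L) :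
    let u : ControlLaw :=
      redesigned α η Tc (slidingControl α₁ α₂ β₁ β₂ p q k Tc₁ Tc₂ ζ) wL
    FixedTimeStable u (admissible L) ∧
    IsUBST u (admissible L) Tc ∧
    (∀ t₀ : ℝ, 0 ≤ t₀ → ∀ x₀ : State, ∀ δ ∈ admissible L t₀, ∀ x : ℝ → State,
      IsTrajectory u δ t₀ x₀ x → ∀ t, t₀ + Tc ≤ t → x t = 0) ∧
    (∃ M : ℝ, ∀ t₀ t : ℝ, t ∈ Set.Icc t₀ (t₀ + Tc) → |kappa α η Tc (t - t₀)| ≤ M) := by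
  intro u
  have hη1 : η < 1 := by rw [hη]; linarith [Real.exp_pos (-α * (Tc₁ + Tc₂))]
  have hη0 : 0 < η := by
    have : Real.exp (-α * (Tc₁ + Tc₂)) < 1 :=
      Real.exp_lt_one_iff.2 (by nlinarith)
    rw [hη]; linarith
  have hpq : p < q := by
    by_contra hcon
    have := mul_le_mul_of_nonneg_left (not_lt.1 hcon) hk.le
    linarith
  have hg := oddProfile_cubic hα₁ hβ₁ hTc₁
  have hc := reachRate_nonneg hα₂ hβ₂ hpq hkp hkq hk hTc₂
  have hce : ∀ s, reachRate α₂ β₂ p q k Tc₂ (-s) = reachRate α₂ β₂ p q k Tc₂ s := fun s => by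
    simp only [reachRate, abs_neg]
  have hflow : ∀ {t₀ : ℝ} {δ : ℝ → ℝ}, δ ∈ admissible L t₀ → ∀ {x₀ : State} {x : ℝ → State},
      IsTrajectory u δ t₀ x₀ x → ReachingFlow (cubicProfile α₁ β₁ Tc₁)
        (cubicProfileDeriv α₁ β₁ Tc₁) (reachRate α₂ β₂ p q k Tc₂) (clockRate α η Tc t₀)
        (fun t => x t 0) (fun t => x t 1 / clockRate α η Tc t₀ t) t₀ (t₀ + Tc) :=
    fun hδ _ _ hx => hx.1.reachingFlow hα hTc hα₁ hβ₁ hp hq hk hTc₁ hη0 hη1 hζ hδ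
  have hzero : ∀ t₀ : ℝ, 0 ≤ t₀ → ∀ x₀ : State, ∀ δ ∈ admissible L t₀, ∀ x : ℝ → State,
      IsTrajectory u δ t₀ x₀ x → ∀ t, t₀ + Tc ≤ t → x t = 0 := by
    intro t₀ ht₀ x₀ δ hδ x hx t ht
    refine hx.1.eq_zero_after hTc hwL ht₀ hδ ?_ ht
    have hi := integrableOn_slowness_cubic hα₁ hβ₁ hTc₁
    have hr := integrableOn_inv_reachRate hα₂ hβ₂ hpq hkp hkq hk hTc₂
    obtain ⟨s, hs, hz⟩ := (hflow hδ hx).exists_eq_zero hg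
      (fun r hr => hasDerivAt_clock hα hTc hη0 hη1 (Ico_subset_Icc_self hr))
      (continuousOn_clockRate hα hTc hη0 hη1) hi.1 hc
      (fun r => reachRate_pos hα₂ hβ₂ hpq hkp hkq hk hTc₂)
      (continuous_reachRate hk hp hq).continuousOn hr.1 hr.2 hce hi.2
      (fun C hC => by
        obtain ⟨r, hr, hlt⟩ := exists_lt_clock (t₀ := t₀) hα hTc hη0 hη1 hη hC
        exact ⟨r, hr, by rw [clock_start, sub_zero]; exact hlt⟩)
      (exists_lt_cubicProfile hα₁ hβ₁ hTc₁)
    have hx0 : ∀ r ∈ Ico s (t₀ + Tc), x r = 0 := fun r hr => by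
      obtain ⟨h1, h2⟩ := hz r hr
      have hpos := clockRate_pos (t₀ := t₀) hα hTc hη0 hη1 (t := r) ⟨hs.1.trans hr.1, hr.2.le⟩
      funext i
      fin_cases i
      · exact h1
      · rcases div_eq_zero_iff.1 h2 with h3 | h3
        · exact h3
        · exact absurd h3 hpos.ne'
    have hcl : t₀ + Tc ∈ closure (Ico s (t₀ + Tc)) := by
      rw [closure_Ico hs.2.ne]; exact right_mem_Icc.2 hs.2.le
    have hcont : ContinuousWithinAt x (Ico s (t₀ + Tc)) (t₀ + Tc) :=
      (hx.1.continuousOn (t₀ + Tc) (by simp [hTc.le])).mono fun r hr => hs.1.trans hr.1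
    have := hcont.mem_closure (t := {0}) hcl fun r hr => hx0 r hr
    simpa using this
  have hubst : IsUBST u (admissible L) Tc := by
    intro x₀ t₀ ht₀
    have hle : settlingTime u (admissible L) x₀ t₀ ≤ ((t₀ + Tc : ℝ) : EReal) - (t₀ : EReal) := by
      refine EReal.sub_le_sub (sInf_le ⟨t₀ + Tc, rfl, by linarith, fun δ hδ x hx => ?_⟩) le_rfl
      have h1 := hx.1.continuousOn (t₀ + Tc) (by simp [hTc.le])
      rw [ContinuousWithinAt, hzero t₀ ht₀ x₀ δ hδ x hx (t₀ + Tc) le_rfl] at h1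
      exact h1
    rwa [← EReal.coe_sub, add_sub_cancel_left] at hle
  refine ⟨⟨fun t₀ ht₀ => ⟨fun ε hε => ?_, fun x₀ δ hδ x hx => ?_⟩, Tc, hTc, hubst⟩, hubst, hzero,
    max 1 (η / (α * (Tc * (1 - η)))), fun t₀ t ht => ?_⟩
  -- R bounds κ on the horizon. As x₂ = κz₂, keeping |z₂| < ε/R and g(|z₁|) < g(ε) suffices, and
  -- `bound` controls both by the continuous function N of the initial state.
  · set R := η / (α * (Tc * (1 - η))) with hR
    have h1η : 0 < 1 - η := by linarith
    have hR0 : 0 < R := by positivity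
    set N : State → ℝ := fun y => |cubicProfile α₁ β₁ Tc₁ (y 0)| +
      2 * (y 1 / clockRate α η Tc t₀ t₀) ^ 2 with hN
    have hNc : Continuous N := by have := hg.continuous; fun_prop
    have hN0 : N 0 = 0 := by simp [hN, hg.zero]
    have hε' : 0 < min (cubicProfile α₁ β₁ Tc₁ ε) (2 * (ε / R) ^ 2) :=
      lt_min (hg.pos hε) (by positivity)
    obtain ⟨d, hd, hball⟩ := Metric.continuousAt_iff.1 hNc.continuousAt _ hε'
    refine ⟨d, hd, fun x₀ hx₀ δ hδ x hx t ht => ?_⟩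
    rcases lt_or_ge t (t₀ + Tc) with htT | htT
    · have hNx := hball (by simpa using hx₀ : dist x₀ 0 < d)
      rw [hN0, dist_zero_right] at hNx
      have hNx' := (le_abs_self _).trans_lt hNx
      have hb := (hflow hδ hx).bound hg hc hce ht htT
      rw [hx.2] at hb
      have htc : t ∈ Icc t₀ (t₀ + Tc) := ⟨ht, htT.le⟩
      have hpos := clockRate_pos (t₀ := t₀) hα hTc hη0 hη1 htc
      have hle := clockRate_le (t₀ := t₀) hα hTc hη0 hη1 htc
      have h0 : |x t 0| < ε := by
        have h1 := hb.1.trans_lt (hNx'.trans_le (min_le_left _ _))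
        rw [hg.abs_apply] at h1
        exact hg.strictMono.lt_iff_lt.1 h1
      have h1 : |x t 1| < ε := by
        have h2 := hb.2.trans_lt (hNx'.trans_le (min_le_right _ _))
        have h3 : |x t 1 / clockRate α η Tc t₀ t| < ε / R :=
          abs_lt_of_sq_lt_sq (by linarith) (by positivity)
        rw [abs_div, abs_of_pos hpos, div_lt_div_iff₀ hpos hR0] at h3
        have h4 : ε * clockRate α η Tc t₀ t ≤ ε * R := by gcongr
        exact lt_of_mul_lt_mul_right (h3.trans_le h4) hR0.le
      rw [pi_norm_lt_iff hε]
      intro i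
      fin_cases i
      · exact h0
      · exact h1
    · rw [hzero t₀ ht₀ x₀ δ hδ x hx t htT]
      simpa using hε
  · refine tendsto_const_nhds.congr' ?_
    filter_upwards [eventually_ge_atTop (t₀ + Tc)] with t ht
    exact (hzero t₀ ht₀ x₀ δ hδ x hx t ht).symm
  · unfold kappa
    split_ifs with h
    · have hpos := clockRate_pos (t₀ := t₀) hα hTc hη0 hη1 ht
      have hle := clockRate_le (t₀ := t₀) hα hTc hη0 hη1 ht
      rw [clockRate] at hpos hle
      rw [abs_of_pos hpos]
      exact hle.trans (le_max_right _ _)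
    · simp
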